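/- **Theorem (Convex Duality).** Let $m\ge 1$, $0\le \ell\le m$, $1<p<\infty$, $q=p/(p-1)$, $\lambda>0$, and let $0\le x_1\le\dots\le x_K\le 1$, $x_0=0$, $x_{K+1}=1$. Let $W_{m,p}$ be the space of functions $f$ on $[0,1]$ with $f,\dots,f^{(m-1)}$ absolutely continuous and $f^{(m)}\in L_p[0,1]$, with norm given by $|\!|\!|f|\!|\!|^p=\sum_{j<m}|f^{(j)}(0)|^p+\int_0^1|f^{(m)}|^p$. Its dual is identified with $W_{m,q}$ through $$\langle\langle g,f\rangle\rangle=\sum_{j<m}g^{(j)}(0)f^{(j)}(0)+\int_0^1 f^{(m)}g^{(m)}\,dt .$$ Let $$V=\{f\in W_{m,p} : (-1)^{k-1}f^{(\ell)}(t)\ge 0 \text{ for } x_{k-1}\le t\le x_k,\ k=1,\dots,K+1\}$$ (for $\ell=m$ the inequalities are required almost everywhere), and let $V^-=\{g\in W_{m,q}:\langle\langle g,f\rangle\rangle\le 0\ \ \forall f\in V\}$ be its negative polar. Let $L_1,\dots,L_N$ be bounded linear functionals on $W_{m,p}$, written $L_if=\langle h_i,f\rangle$, let $\rho_1,\dots,\rho_N:\mathbb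 R\to\mathbb R$ be strictly convex and continuous, and let $y\in\mathbb R^N$. The primal problem is to minimize over $f\in V$ $$\mathrm{VP}[f]=\frac{\lambda}{p}\int_0^1|f^{(m)}(s)|^p\,ds+\sum_{i=1}^N\rho_i\big(\langle h_i,f\rangle-y_i\big).$$ Let $$R_t(s)=\sum_{j<m}\frac{t^js^j}{(j!)^2}+\int_0^{\min\{t,s\}}\frac{(t-u)^{m-1}(s-u)^{m-1}}{[(m-1)!]^2}\,du,$$ $b_i(t)=L_iR_t$ and $B\alpha=\sum_i\alpha_ib_i$. Let $\rho_i^*(a)=\sup_z(az-\rho_i(z))\in(-\infty,\infty]$, and for $g\in W_{m,q}$ let $$\int_0^1|[\mathbf P_x^*g]^{(m)}|^q\,ds:=\inf\Big\{\int_0^1|g^{(m)}-\tilde g^{(m)}|^q\,ds:\ \tilde g\in V^-,\ \tilde g^{(j)}(0)=g^{(j)}(0),\ 0\le j<m\Big\}\in[0,\infty]$$ (with $\inf\emptyset=\infty$). Consider on $\mathbb R^N$ the functional $$\mathrm{VP}^*[\alpha]=\frac{\lambda^{1-q}}{q}\int_0^1\big|[\mathbf P_x^*(-B\alpha)]^{(m)}(s)\big|^q\,ds+\sum_{i=1}^N\big(\rho_i^*(\alpha_i)+\alpha_iy_i\big).$$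 1. Minimizing $\mathrm{VP}^*$ is the Fenchel dual of the primal problem: for all $\alpha$, $$\mathrm{VP}^*[\alpha]=\sup_{f\in V}\Big(-\sum_i\alpha_iL_if-\frac\lambda p\int_0^1|f^{(m)}|^p\Big)+\sup_{z\in\mathbb R^N}\Big(\sum_i\alpha_iz_i-\sum_i\rho_i(z_i-y_i)\Big).$$ 2. $\mathrm{VP}^*$ is convex with values in $(-\infty,\infty]$, and if all $\rho_i$ are differentiable it is strictly convex on the convex set where it is finite. 3. $\mathrm{VP}^*$ attains its minimum over $\mathbb R^N$, and $$\min_{\alpha\in\mathbb R^N}\mathrm{VP}^*[\alpha]=-\inf_{f\in V}\mathrm{VP}[f]$$ (as extended real numbers; if the primal infimum is $-\infty$, then $\mathrm{VP}^*\equiv+\infty$). 4. Suppose that the $h_i$ (that is, the $L_i$) are linearly independent. Let $\hat f$ be a minimizer of $\mathrm{VP}$ over $V$, let $\alpha$ be a minimizer of $\mathrm{VP}^*$, and let $i\in\{1,\dots,N\}$. Then $\alpha_i$ is a subgradient of $\rho_i$ at $\langle h_i,\hat f\rangle-y_i$, so that $$\alpha_i=\rho_i'\big(\langle h_i,\hat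 f\rangle-y_i\big)$$ if $\rho_i$ is differentiable at that point. Moreover $\rho_i^*$ is finite near $\alpha_i$ and differentiable at $\alpha_i$, with $$\langle h_i,\hat f\rangle-y_i=\rho_i^{*\prime}(\alpha_i).$$ -/

import Mathlib

open MeasureTheory Set

namespace RobustSpline

noncomputable section

/-- The `j`-th derivative on `[0,1]` (one-sided at the end points) of a function on `[0,1]`.
Only its values at points of `[0,1]` are ever used. -/
def der (j : ℕ) (f : unitInterval → ℝ) : ℝ → ℝ :=
  iteratedDerivWithin j (IccExtend zero_le_one f) (Icc 0 1)

/-- `f, f', …, f^(m-1)` exist and are absolutely continuous on `[0,1]`, and `f^(m) ∈ L_p[0,1]`. -/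
def MemW (m : ℕ) (p : ℝ) (f : unitInterval → ℝ) : Prop :=
  (∀ j, j + 1 < m → DifferentiableOn ℝ (der j f) (Icc 0 1)) ∧
  (∀ j, j < m → AbsolutelyContinuousOnInterval (der j f) 0 1) ∧
  MemLp (der m f) (ENNReal.ofReal p) (volume.restrict (Icc 0 1))

/-! ### Helper facts: the Sobolev space is a vector space -/

theorem ac_congr {f g : ℝ → ℝ} (hf : AbsolutelyContinuousOnInterval f 0 1)
    (h : EqOn f g (Icc 0 1)) : AbsolutelyContinuousOnInterval g 0 1 := by
  rw [absolutelyContinuousOnInterval_iff] at hf ⊢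
  intro ε hε
  obtain ⟨δ, hδ, H⟩ := hf ε hε
  refine ⟨δ, hδ, fun E hE hE' => ?_⟩
  have := H E hE hE'
  convert this using 1
  refine Finset.sum_congr rfl fun i hi => ?_
  have hm := hE.1 i hi
  rw [uIcc_of_le zero_le_one] at hm
  rw [h hm.1, h hm.2]

theorem memW_contDiffOn {n : ℕ} {p : ℝ} {f : unitInterval → ℝ} (hf : MemW (n + 1) p f) :
    ContDiffOn ℝ n (IccExtend zero_le_one f) (Icc 0 1) := by
  refine contDiffOn_of_continuousOn_differentiableOn_deriv ?_ ?_
  · intro j hj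
    have hj' : j ≤ n := by exact_mod_cast hj
    have := (hf.2.1 j (by omega)).continuousOn
    rwa [uIcc_of_le zero_le_one] at this
  · intro j hj
    have hj' : j < n := by exact_mod_cast hj
    exact hf.1 j (by omega)

theorem der_add {n : ℕ} {p : ℝ} {f g : unitInterval → ℝ} (hf : MemW (n + 1) p f)
    (hg : MemW (n + 1) p g) {j : ℕ} (hj : j ≤ n) :
    EqOn (der j f + der j g) (der j (f + g)) (Icc 0 1) := by
  intro t ht
  have h1 := ((memW_contDiffOn hf) t ht).of_le (m := (j : ℕ)) (by exact_mod_cast hj)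
  have h2 := ((memW_contDiffOn hg) t ht).of_le (m := (j : ℕ)) (by exact_mod_cast hj)
  exact (iteratedDerivWithin_add ht (uniqueDiffOn_Icc zero_lt_one) h1 h2).symm

theorem der_succ (j : ℕ) (f : unitInterval → ℝ) (t : ℝ) :
    der (j + 1) f t = derivWithin (der j f) (Icc 0 1) t :=
  congrFun iteratedDerivWithin_succ t

theorem der_smul (c : ℝ) (j : ℕ) (f : unitInterval → ℝ) :
    der j (c • f) = fun t => c * der j f t := by
  funext t
  exact iteratedDerivWithin_const_smul_field (𝕜 := ℝ) c (IccExtend zero_le_one f)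

theorem der_top_add {n : ℕ} {p : ℝ} {f g : unitInterval → ℝ} (hf : MemW (n + 1) p f)
    (hg : MemW (n + 1) p g) :
    der (n + 1) f + der (n + 1) g =ᵐ[volume.restrict (Icc 0 1)] der (n + 1) (f + g) := by
  have a := (hf.2.1 n (by omega)).ae_differentiableAt
  have b := (hg.2.1 n (by omega)).ae_differentiableAt
  rw [Filter.EventuallyEq, ae_restrict_iff' measurableSet_Icc]
  filter_upwards [a, b] with t ha hb ht
  have ht' : t ∈ uIcc (0 : ℝ) 1 := by rwa [uIcc_of_le zero_le_one]
  rw [Pi.add_apply, der_succ, der_succ, der_succ,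
    ← derivWithin_add (ha ht').differentiableWithinAt (hb ht').differentiableWithinAt]
  exact derivWithin_congr (der_add hf hg le_rfl) (der_add hf hg le_rfl ht)

theorem MemW.add {m : ℕ} {p : ℝ} {f g : unitInterval → ℝ} (hf : MemW m p f)
    (hg : MemW m p g) : MemW m p (f + g) := by
  rcases m with _ | n
  · refine ⟨by simp, by simp, ?_⟩
    exact hf.2.2.add hg.2.2
  · refine ⟨fun j hj => ?_, fun j hj => ?_, ?_⟩
    · exact ((hf.1 j hj).add (hg.1 j hj)).congr fun t ht => (der_add hf hg (by omega) ht).symm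
    · exact ac_congr ((hf.2.1 j hj).add (hg.2.1 j hj)) (der_add hf hg (by omega))
    · exact (hf.2.2.add hg.2.2).ae_eq (der_top_add hf hg)

theorem MemW.smul {m : ℕ} {p : ℝ} {f : unitInterval → ℝ} (c : ℝ) (hf : MemW m p f) :
    MemW m p (c • f) := by
  refine ⟨fun j hj => ?_, fun j hj => ?_, ?_⟩
  · rw [der_smul]; exact (hf.1 j hj).const_mul c
  · rw [der_smul]; exact (hf.2.1 j hj).const_mul c
  · rw [der_smul]; exact hf.2.2.const_mul c

theorem lipschitz_derivWithin_memLp {p : ℝ} {C : NNReal} {G : ℝ → ℝ} (hG : LipschitzWith C G) :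
    MemLp (derivWithin G (Icc 0 1)) (ENNReal.ofReal p) (volume.restrict (Icc 0 1)) := by
  have h : deriv G =ᵐ[volume.restrict (Icc 0 1)] derivWithin G (Icc 0 1) := by
    rw [← restrict_Ioo_eq_restrict_Icc, Filter.EventuallyEq, ae_restrict_iff' measurableSet_Ioo]
    refine Filter.Eventually.of_forall fun t ht => ?_
    rw [derivWithin_of_mem_nhds (Icc_mem_nhds ht.1 ht.2)]
  refine MemLp.ae_eq h (MemLp.of_bound (measurable_deriv G).aestronglyMeasurable C ?_)
  exact Filter.Eventually.of_forall fun t => norm_deriv_le_of_lipschitz hG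

theorem memW_of_chain {n : ℕ} {p : ℝ} {f : unitInterval → ℝ} (G : ℕ → ℝ → ℝ)
    (h0 : ∀ t : unitInterval, f t = G 0 t)
    (hd : ∀ j, j < n → ∀ s, HasDerivAt (G j) (G (j + 1) s) s)
    (hL : ∃ C, LipschitzWith C (G n)) : MemW (n + 1) p f := by
  have key : ∀ j, j ≤ n → EqOn (der j f) (G j) (Icc 0 1) := by
    intro j
    induction j with
    | zero =>
      intro _ t ht
      simp [der, IccExtend_of_mem _ f ht, h0]
    | succ j ih =>
      intro hj t ht
      have e := ih (by omega)
      rw [der_succ, derivWithin_congr e (e ht)]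
      exact (hd j (by omega) t).hasDerivWithinAt.derivWithin (uniqueDiffOn_Icc zero_lt_one t ht)
  obtain ⟨C, hC⟩ := hL
  have hdiff : ∀ j, j < n → DifferentiableOn ℝ (der j f) (Icc 0 1) := fun j hj =>
    DifferentiableOn.congr
      (fun t _ => (hd j hj t).differentiableAt.differentiableWithinAt) (key j hj.le)
  refine ⟨fun j hj => hdiff j (by omega), fun j hj => ?_, ?_⟩
  · refine ac_congr ?_ (key j (by omega)).symm
    rcases Nat.lt_or_ge j n with h | h
    · have hcont : Continuous (G (j + 1)) := by
        rcases Nat.lt_or_ge (j + 1) n with h' | h'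
        · exact continuous_iff_continuousAt.2 fun s => (hd (j + 1) h' s).continuousAt
        · have : j + 1 = n := by omega
          rw [this]; exact hC.continuous
      have : ContDiff ℝ 1 (G j) := by
        rw [contDiff_one_iff_deriv]
        refine ⟨fun s => (hd j h s).differentiableAt, ?_⟩
        rwa [show deriv (G j) = G (j + 1) from funext fun s => (hd j h s).deriv]
      exact this.contDiffOn.absolutelyContinuousOnInterval
    · have : j = n := by omega
      subst this
      exact (hC.lipschitzOnWith (s := uIcc 0 1)).absolutelyContinuousOnInterval
  · refine (lipschitz_derivWithin_memLp (p := p) hC).ae_eq ?_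
    rw [Filter.EventuallyEq, ae_restrict_iff' measurableSet_Icc]
    refine Filter.Eventually.of_forall fun t ht => ?_
    rw [der_succ, derivWithin_congr (key n le_rfl) (key n le_rfl ht)]

/-- The Sobolev space `W_{m,p}[0,1]`. -/
def W (m : ℕ) (p : ℝ) : Submodule ℝ (unitInterval → ℝ) where
  carrier := {f | MemW m p f}
  add_mem' := fun hf hg => MemW.add hf hg
  zero_mem' := by
    have h : ∀ j, der j (0 : unitInterval → ℝ) = fun _ => 0 := by
      intro j
      have := der_smul 0 j 0
      simpa using this
    refine ⟨fun j _ => ?_, fun j _ => ?_, ?_⟩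
    · rw [h]; exact differentiableOn_const 0
    · rw [h]
      exact (contDiffOn_const (n := 1) (c := (0 : ℝ))).absolutelyContinuousOnInterval
    · rw [h]; exact MemLp.zero
  smul_mem' := fun c _ hf => MemW.smul c hf

/-- The norm of `W_{m,p}`. -/
def wNorm {m : ℕ} {p : ℝ} (f : W m p) : ℝ :=
  (∑ j ∈ Finset.range m, |der j f 0| ^ p + ∫ s in (0 : ℝ)..1, |der m f s| ^ p) ^ (1 / p)

/-- `L` is a bounded linear functional on `W_{m,p}`. -/
def IsBoundedFunctional {m : ℕ} {p : ℝ} (L : W m p →ₗ[ℝ] ℝ) : Prop :=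
  ∃ C : ℝ, ∀ f, |L f| ≤ C * wNorm f

/-- The duality pairing of `g ∈ W_{m,q}` and `f ∈ W_{m,p}`. -/
def pairing {m : ℕ} {p q : ℝ} (g : W m q) (f : W m p) : ℝ :=
  ∑ j ∈ Finset.range m, der j g 0 * der j f 0 + ∫ s in (0 : ℝ)..1, der m f s * der m g s

/-- The reproducing kernel `R_t(s)`. -/
def kernelR (m : ℕ) (t s : unitInterval) : ℝ :=
  ∑ j ∈ Finset.range m, ((t : ℝ) ^ j / j.factorial) * ((s : ℝ) ^ j / j.factorial) +
    ∫ u in (0 : ℝ)..min (t : ℝ) s,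
      ((t : ℝ) - u) ^ (m - 1) * ((s : ℝ) - u) ^ (m - 1) / ((m - 1).factorial : ℝ) ^ 2

/-! ### Helper facts: `R_t` belongs to `W_{m,p}` -/

/-- The truncated power `r_+^k / k!`. -/
def tpow (k : ℕ) (r : ℝ) : ℝ := if 0 < r then r ^ k / k.factorial else 0

theorem tpow_succ (k : ℕ) (r : ℝ) :
    tpow (k + 1) r = (max r 0) ^ (k + 1) / (k + 1).factorial := by
  unfold tpow
  split_ifs with h
  · rw [max_eq_left h.le]
  · rw [max_eq_right (not_lt.1 h)]; simp

theorem tpow_measurable (k : ℕ) : Measurable (tpow k) :=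
  Measurable.ite measurableSet_Ioi (by fun_prop) measurable_const

theorem tpow_hasDerivAt (k : ℕ) {r : ℝ} (hr : r ≠ 0) :
    HasDerivAt (tpow (k + 1)) (tpow k r) r := by
  rcases lt_or_gt_of_ne hr with h | h
  · have : tpow k r = 0 := by simp [tpow, h.le]
    rw [this]
    refine (hasDerivAt_const r (0 : ℝ)).congr_of_eventuallyEq ?_
    filter_upwards [gt_mem_nhds h] with x hx
    simp [tpow, le_of_lt hx]
  · have e : tpow k r = ((k + 1 : ℕ) : ℝ) * r ^ k / (k + 1).factorial := by
      have h1 : ((k : ℝ) + 1) ≠ 0 := by positivity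
      have h2 : (k.factorial : ℝ) ≠ 0 := by positivity
      simp only [tpow, h, if_true, Nat.factorial_succ]
      push_cast
      field_simp
    rw [e]
    have := (hasDerivAt_pow (k + 1) r).div_const ((k + 1).factorial : ℝ)
    simp only [Nat.add_sub_cancel] at this
    refine this.congr_of_eventuallyEq ?_
    filter_upwards [lt_mem_nhds h] with x hx
    simp [tpow, hx]

theorem tpow_abs_le (k : ℕ) {r M : ℝ} (hM : 0 ≤ M) (hr : |r| ≤ M) : |tpow k r| ≤ M ^ k := by
  unfold tpow
  split_ifs with h
  · rw [abs_div, abs_pow, Nat.abs_cast]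
    refine (div_le_self (by positivity) ?_).trans (pow_le_pow_left₀ (abs_nonneg _) hr k)
    exact_mod_cast Nat.one_le_iff_ne_zero.2 (Nat.factorial_ne_zero k)
  · simpa using pow_nonneg hM k

theorem tpow_lip (k : ℕ) {a b M : ℝ} (hM : 0 ≤ M) (ha : |a| ≤ M) (hb : |b| ≤ M) :
    |tpow (k + 1) a - tpow (k + 1) b| ≤ (k + 1) * M ^ k * |a - b| := by
  rw [tpow_succ, tpow_succ, ← sub_div, abs_div, Nat.abs_cast]
  refine (div_le_self (abs_nonneg _) ?_).trans ?_
  · exact_mod_cast Nat.one_le_iff_ne_zero.2 (Nat.factorial_ne_zero (k + 1))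
  refine (abs_pow_sub_pow_le _ _ _).trans ?_
  have h1 : |max a 0 - max b 0| ≤ |a - b| := abs_max_sub_max_le_abs a b 0
  have h2 : ∀ c : ℝ, |c| ≤ M → |max c 0| ≤ M := fun c hc => by
    rw [abs_of_nonneg (le_max_right _ _)]
    exact max_le ((le_abs_self c).trans hc) hM
  have h3 : max |max a 0| |max b 0| ^ (k + 1 - 1) ≤ M ^ k := by
    rw [Nat.add_sub_cancel]
    exact pow_le_pow_left₀ (le_max_of_le_left (abs_nonneg _)) (max_le (h2 a ha) (h2 b hb)) k
  calc |max a 0 - max b 0| * ((k + 1 : ℕ) : ℝ) * max |max a 0| |max b 0| ^ (k + 1 - 1)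
      ≤ |a - b| * ((k + 1 : ℕ) : ℝ) * M ^ k := by gcongr
    _ = (k + 1) * M ^ k * |a - b| := by push_cast; ring

/-- `∫_0^1 (t-u)_+^n / n! * (s-u)_+^k / k! du`. -/
def conv (n k : ℕ) (t s : ℝ) : ℝ := ∫ u in Ioc (0 : ℝ) 1, tpow n (t - u) * tpow k (s - u)

theorem conv_meas (n k : ℕ) (t s : ℝ) :
    Measurable fun u => tpow n (t - u) * tpow k (s - u) :=
  ((tpow_measurable n).comp (measurable_const.sub measurable_id)).mul
    ((tpow_measurable k).comp (measurable_const.sub measurable_id))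

theorem tpow_unit (n : ℕ) (t : unitInterval) {u : ℝ} (hu : u ∈ Ioc (0 : ℝ) 1) :
    |tpow n ((t : ℝ) - u)| ≤ 1 := by
  have := tpow_abs_le n zero_le_one (r := (t : ℝ) - u)
    (abs_le.2 ⟨by linarith [t.2.1, hu.2], by linarith [t.2.2, hu.1]⟩)
  simpa using this

theorem conv_integrable (n k : ℕ) (t : unitInterval) (s : ℝ) :
    Integrable (fun u => tpow n (t - u) * tpow k (s - u)) (volume.restrict (Ioc (0 : ℝ) 1)) := by
  refine Integrable.of_bound (conv_meas n k t s).aestronglyMeasurable ((|s| + 1) ^ k) ?_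
  rw [ae_restrict_iff' measurableSet_Ioc]
  refine Filter.Eventually.of_forall fun u hu => ?_
  have h1 := tpow_unit n t hu
  have h2 := tpow_abs_le k (r := s - u) (M := |s| + 1) (by positivity)
    ((abs_sub _ _).trans (by gcongr; exact abs_le.2 ⟨by linarith [hu.1], hu.2⟩))
  rw [Real.norm_eq_abs, abs_mul]
  nlinarith [abs_nonneg (tpow k (s - u)), abs_nonneg (tpow n ((t : ℝ) - u))]

theorem conv_hasDerivAt (n k : ℕ) (t : unitInterval) (s : ℝ) :
    HasDerivAt (conv n (k + 1) t) (conv n k t s) s := by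
  have hball : Metric.ball s 1 ∈ nhds s := Metric.ball_mem_nhds s one_pos
  refine (hasDerivAt_integral_of_dominated_loc_of_lip (μ := volume.restrict (Ioc (0 : ℝ) 1))
    (F := fun s u => tpow n ((t : ℝ) - u) * tpow (k + 1) (s - u))
    (F' := fun u => tpow n ((t : ℝ) - u) * tpow k (s - u))
    (bound := fun _ => (k + 1) * (|s| + 2) ^ k) hball ?_ ?_ ?_ ?_ ?_ ?_).2
  · exact Filter.Eventually.of_forall fun x => (conv_meas n (k + 1) t x).aestronglyMeasurable
  · exact conv_integrable n (k + 1) t s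
  · exact (conv_meas n k t s).aestronglyMeasurable
  · rw [ae_restrict_iff' measurableSet_Ioc]
    refine Filter.Eventually.of_forall fun u hu => ?_
    refine LipschitzOnWith.of_dist_le_mul fun a ha b hb => ?_
    have hB : ∀ c ∈ Metric.ball s 1, |c - u| ≤ |s| + 2 := fun c hc => by
      rw [Metric.mem_ball, Real.dist_eq] at hc
      have := abs_lt.1 hc
      have := abs_le.1 (le_refl |s|)
      exact abs_le.2 ⟨by linarith [hu.2], by linarith [hu.1]⟩
    rw [Real.dist_eq, Real.dist_eq, ← mul_sub, abs_mul,
      Real.coe_nnabs, abs_of_nonneg (by positivity : (0 : ℝ) ≤ (k + 1) * (|s| + 2) ^ k)]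
    have h1 := tpow_unit n t hu
    have h2 := tpow_lip k (by positivity) (hB a ha) (hB b hb)
    rw [sub_sub_sub_cancel_right] at h2
    nlinarith [abs_nonneg (tpow (k + 1) (a - u) - tpow (k + 1) (b - u)),
      abs_nonneg (tpow n ((t : ℝ) - u))]
  · exact integrable_const _
  · have hne : ∀ᵐ u ∂(volume.restrict (Ioc (0 : ℝ) 1)), u ≠ s :=
      ae_restrict_of_ae (Measure.ae_ne volume s)
    filter_upwards [hne] with u hu
    have := (tpow_hasDerivAt k (sub_ne_zero.2 hu.symm)).comp_sub_const s u
    exact this.const_mul _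

theorem conv_zero_lipschitz (n : ℕ) (t : unitInterval) : LipschitzWith 1 (conv n 0 t) := by
  refine LipschitzWith.of_dist_le_mul fun a b => ?_
  rw [Real.dist_eq, Real.dist_eq, NNReal.coe_one, one_mul]
  unfold conv
  rw [← integral_sub (conv_integrable n 0 t a) (conv_integrable n 0 t b), ← Real.norm_eq_abs]
  have hint : Integrable ((uIcc a b).indicator fun _ => (1 : ℝ)) :=
    (integrable_indicator_iff measurableSet_uIcc).2
      (integrableOn_const (isCompact_uIcc.measure_lt_top.ne))
  have hb : ∀ᵐ u ∂(volume.restrict (Ioc (0 : ℝ) 1)),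
      ‖tpow n (t - u) * tpow 0 (a - u) - tpow n (t - u) * tpow 0 (b - u)‖ ≤
        (uIcc a b).indicator (fun _ => (1 : ℝ)) u := by
    rw [ae_restrict_iff' measurableSet_Ioc]
    refine Filter.Eventually.of_forall fun u hu => ?_
    have h1 := tpow_unit n t hu
    rw [← mul_sub, Real.norm_eq_abs, abs_mul]
    have h2 : |tpow 0 (a - u) - tpow 0 (b - u)| ≤ (uIcc a b).indicator (fun _ => (1 : ℝ)) u := by
      by_cases hm : u ∈ uIcc a b
      · rw [indicator_of_mem hm]
        unfold tpow
        split_ifs <;> simp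
      · rw [indicator_of_notMem hm]
        rw [mem_uIcc, not_or, not_and_or, not_and_or, not_le, not_le, not_le, not_le] at hm
        have : (0 < a - u ↔ 0 < b - u) := by
          rw [sub_pos, sub_pos]
          constructor <;> intro h <;> by_contra! h' <;>
            rcases hm with ⟨h3 | h3, h4 | h4⟩ <;> linarith
        unfold tpow
        simp [this]
    calc _ ≤ 1 * |tpow 0 (a - u) - tpow 0 (b - u)| := by gcongr
      _ ≤ _ := by rwa [one_mul]
  calc _ ≤ ∫ u in Ioc (0 : ℝ) 1, (uIcc a b).indicator (fun _ => (1 : ℝ)) u :=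
        norm_integral_le_of_norm_le hint.restrict hb
    _ ≤ ∫ u, (uIcc a b).indicator (fun _ => (1 : ℝ)) u :=
        setIntegral_le_integral hint
          (Filter.Eventually.of_forall fun u => indicator_nonneg (fun _ _ => zero_le_one) u)
    _ = |a - b| := by
        rw [integral_indicator measurableSet_uIcc]
        simp [Measure.real, Real.volume_interval, abs_sub_comm]

theorem memW_conv (n : ℕ) (p : ℝ) (t : unitInterval) :
    MemW (n + 1) p fun s => conv n n t s := by
  refine memW_of_chain (fun j => conv n (n - j) t) (fun s => rfl) (fun j hj s => ?_)
    ⟨1, by simpa using conv_zero_lipschitz n t⟩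
  have e : n - j = (n - (j + 1)) + 1 := by omega
  rw [e]
  exact conv_hasDerivAt n _ t s

theorem memW_monomial (n i : ℕ) (hi : i ≤ n) (p : ℝ) :
    MemW (n + 1) p fun s => (s : ℝ) ^ i / i.factorial := by
  refine memW_of_chain
    (fun j s => if j ≤ i then s ^ (i - j) / (i - j).factorial else 0) (fun s => by simp)
    (fun j hj s => ?_) ⟨0, ?_⟩
  · rcases lt_trichotomy j i with h | h | h
    · obtain ⟨k, rfl⟩ : ∃ k, i = j + 1 + k := ⟨i - (j + 1), by omega⟩
      have e1 : j + 1 + k - j = k + 1 := by omega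
      have e2 : j + 1 + k - (j + 1) = k := by omega
      have e3 : j ≤ j + 1 + k := by omega
      simp only [e1, e2, e3, Nat.le_add_right, if_true]
      have := (hasDerivAt_pow (k + 1) s).div_const ((k + 1).factorial : ℝ)
      simp only [Nat.add_sub_cancel] at this
      have h1 : ((k : ℝ) + 1) ≠ 0 := by positivity
      have h2 : (k.factorial : ℝ) ≠ 0 := by positivity
      have e4 : ((k + 1 : ℕ) : ℝ) * s ^ k / (k + 1).factorial = s ^ k / k.factorial := by
        rw [Nat.factorial_succ]
        push_cast
        field_simp
      rwa [e4] at this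
    · subst h
      simpa using hasDerivAt_const s (1 : ℝ)
    · have h1 : ¬ j ≤ i := by omega
      have h2 : ¬ j + 1 ≤ i := by omega
      simpa [h1, h2] using hasDerivAt_const s (0 : ℝ)
  · refine LipschitzWith.of_dist_le_mul fun a b => ?_
    rcases Nat.lt_or_ge i n with h | h
    · have : ¬ n ≤ i := by omega
      simp [this]
    · have : i = n := by omega
      subst this
      simp

theorem kernelR_eq (n : ℕ) (t s : unitInterval) :
    kernelR (n + 1) t s =
      ∑ j ∈ Finset.range (n + 1), ((t : ℝ) ^ j / j.factorial) * ((s : ℝ) ^ j / j.factorial) +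
        conv n n t s := by
  unfold kernelR conv
  congr 1
  have h0 : (0 : ℝ) ≤ min (t : ℝ) s := le_min t.2.1 s.2.1
  have h1 : Ioc (0 : ℝ) (min (t : ℝ) s) ⊆ Ioc 0 1 :=
    Ioc_subset_Ioc_right ((min_le_left _ _).trans t.2.2)
  rw [intervalIntegral.integral_of_le h0, integral_Ioc_eq_integral_Ioo]
  have h2 : Ioo (0 : ℝ) (min (t : ℝ) s) ⊆ Ioc 0 1 := Ioo_subset_Ioc_self.trans h1
  have h3 : ∫ u in Ioc (0 : ℝ) 1, tpow n ((t : ℝ) - u) * tpow n ((s : ℝ) - u) =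
      ∫ u in Ioo (0 : ℝ) (min (t : ℝ) s), tpow n ((t : ℝ) - u) * tpow n ((s : ℝ) - u) := by
    refine setIntegral_eq_of_subset_of_forall_sdiff_eq_zero measurableSet_Ioc h2 fun u hu => ?_
    have : ¬ u < min (t : ℝ) s := fun h => hu.2 ⟨hu.1.1, h⟩
    rw [lt_min_iff, not_and_or] at this
    rcases this with h | h <;> simp [tpow, h]
  rw [h3]
  · refine setIntegral_congr_fun measurableSet_Ioo fun u hu => ?_
    have ht := hu.2.trans_le (min_le_left _ _)
    have hs := hu.2.trans_le (min_le_right _ _)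
    simp only [tpow, sub_pos, ht, hs, if_true, Nat.add_sub_cancel]
    ring

theorem kernelR_mem {m : ℕ} (hm : 1 ≤ m) (p : ℝ) (t : unitInterval) :
    kernelR m t ∈ W m p := by
  obtain ⟨n, rfl⟩ : ∃ n, m = n + 1 := ⟨m - 1, by omega⟩
  have e : kernelR (n + 1) t = (∑ j ∈ Finset.range (n + 1),
      ((t : ℝ) ^ j / j.factorial) • fun s : unitInterval => (s : ℝ) ^ j / j.factorial) +
        fun s : unitInterval => conv n n t s := by
    funext s
    rw [kernelR_eq]
    simp
  rw [e]
  refine (W (n + 1) p).add_mem ((W (n + 1) p).sum_mem fun j hj => ?_) (memW_conv n p t)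
  exact (W (n + 1) p).smul_mem _
    (memW_monomial n j (by have := Finset.mem_range.1 hj; omega) p)

/-- `R_t` (equivalently `R(·,t)`, as `R` is symmetric) as an element of `W_{m,p}`. -/
def kernelElt {m : ℕ} (hm : 1 ≤ m) (p : ℝ) (t : unitInterval) : W m p :=
  ⟨kernelR m t, kernelR_mem hm p t⟩

/-! ### Cones, primal and dual problems -/

/-- The nodes `x_0 = 0`, `x_1, …, x_K`, `x_{K+1} = 1`. -/
def node {K : ℕ} (x : Fin K → ℝ) : ℕ → ℝ
  | 0 => 0
  | k + 1 => if h : k < K then x ⟨k, h⟩ else 1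

/-- The cone `V^{K,ℓ}_{m,p}[x_1,…,x_K]`: `(-1)^k f^(ℓ)(t) ≥ 0` for `x_k ≤ t ≤ x_{k+1}`,
`k = 0,…,K`; for `ℓ = m` the inequalities are required almost everywhere. -/
def coneV (m : ℕ) (p : ℝ) (l : ℕ) {K : ℕ} (x : Fin K → ℝ) : Set (W m p) :=
  {f | ∀ k, k ≤ K →
    (l < m → ∀ t ∈ Icc (node x k) (node x (k + 1)), 0 ≤ (-1 : ℝ) ^ k * der l f t) ∧
    (l = m → ∀ᵐ t : ℝ, t ∈ Icc (node x k) (node x (k + 1)) → 0 ≤ (-1 : ℝ) ^ k * der l f t)}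

/-- The negative polar of `C ⊆ W_{m,p}`, as a subset of `W_{m,q}`, which is the dual space of
`W_{m,p}` under the pairing. -/
def negPolar {m : ℕ} {p : ℝ} (q : ℝ) (C : Set (W m p)) : Set (W m q) :=
  {g | ∀ f ∈ C, pairing g f ≤ 0}

/-- The penalty `(lam / p) ∫ |f^(m)|^p`. -/
def penalty {m : ℕ} {p : ℝ} (lam : ℝ) (f : W m p) : ℝ :=
  lam / p * ∫ s in (0 : ℝ)..1, |der m f s| ^ p

/-- The primal functional `VP[f]`; `L i f` is `⟨h_i, f⟩`. -/
def VP {m : ℕ} {p : ℝ} {N : ℕ} (lam : ℝ) (L : Fin N → W m p →ₗ[ℝ] ℝ) (ρ : Fin N → ℝ → ℝ)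
    (y : Fin N → ℝ) (f : W m p) : ℝ :=
  penalty lam f + ∑ i, ρ i (L i f - y i)

/-- The Fenchel/Legendre transform of `r : ℝ → ℝ`. -/
def conj (r : ℝ → ℝ) (a : ℝ) : EReal := ⨆ z : ℝ, ((a * z - r z : ℝ) : EReal)

/-- `Bα(t) = ∑ α_i b_i(t)` with `b_i(t) = L_i R(·,t)`. -/
def B {m : ℕ} (hm : 1 ≤ m) {p : ℝ} {N : ℕ} (L : Fin N → W m p →ₗ[ℝ] ℝ) (α : Fin N → ℝ) :
    unitInterval → ℝ :=
  fun t => ∑ i, L i (kernelElt hm p t) * α i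

/-- The quantity `∫ |[P^* g]^(m)|^q`: the infimum of `∫ |g^(m) - g'^(m)|^q` over `g'` in the
polar cone `D` with `g'^(j)(0) = g^(j)(0)` for `j < m` (it is `∞` if there is no such `g'`). -/
def projEnergy {m : ℕ} {q : ℝ} (D : Set (W m q)) (g : unitInterval → ℝ) : ENNReal :=
  ⨅ (g' : W m q) (_ : g' ∈ D) (_ : ∀ j < m, der j g 0 = der j g' 0),
    ∫⁻ s in Icc (0 : ℝ) 1, ‖der m g s - der m g' s‖ₑ ^ q

/-- The dual functional
`(lam^(1-q) / q) ∫ |[P^*(-Bα)]^(m)|^q + ∑ (ρ_i^*(α_i) + α_i y_i)`, for a cone `V`. -/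
def dualVP {m : ℕ} (hm : 1 ≤ m) {p : ℝ} (q : ℝ) {N : ℕ} (lam : ℝ) (V : Set (W m p))
    (L : Fin N → W m p →ₗ[ℝ] ℝ) (ρ : Fin N → ℝ → ℝ) (y : Fin N → ℝ) (α : Fin N → ℝ) : EReal :=
  ((lam ^ (1 - q) / q : ℝ) : EReal) * (projEnergy (negPolar q V) (-B hm L α) : EReal) +
    ∑ i, (conj (ρ i) (α i) + ((α i * y i : ℝ) : EReal))

/-- The Fenchel dual functional `U^*(-∑ α_i L_i) + Φ^*(α)` of the primal problem
`inf_f U(f) + Φ(L_1 f, …, L_N f)`, where `U` is the penalty plus the indicator function of `V`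
and `Φ(z) = ∑ ρ_i(z_i - y_i)`. -/
def fenchelDual {m : ℕ} {p : ℝ} {N : ℕ} (lam : ℝ) (V : Set (W m p))
    (L : Fin N → W m p →ₗ[ℝ] ℝ) (ρ : Fin N → ℝ → ℝ) (y : Fin N → ℝ) (α : Fin N → ℝ) : EReal :=
  (⨆ f ∈ V, ((-(∑ i, α i * L i f) - penalty lam f : ℝ) : EReal)) +
    ⨆ z : Fin N → ℝ, ((∑ i, α i * z i - ∑ i, ρ i (z i - y i) : ℝ) : EReal)

end

end RobustSpline

open MeasureTheory Set

namespace RobustSpline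

/-! ### Separation and suprema of affine functions -/

/-! Write the primal problem as `inf_f U(f) + Φ(L f)`, where `U` is the penalty plus the indicator
of the cone `V` and `Φ` is the fidelity term. Its Fenchel dual is `U^*(-∑ α_i L_i) + Φ^*(α)`.

`Φ^*` separates into the one-dimensional conjugates. To compute `U^*` (`mul_projEnergy_eq`), the
Taylor data identify `W_{m,p}` with `ℝ^m × L_p`, so its continuous functionals are pairings with
elements of `W_{m,q}`, and the reproducing kernel shows that `-Bα` represents `-∑ α_i L_i`. Young's
inequality bounds `U^*` by the energy of the difference to any admissible element of the polar cone.
Conversely, Hahn–Banach separation produces a polar element that meets the bound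
(`exists_negPolar`).

Strong duality (`exists_dual_attaining`) is a second separation, in `ℝ^N × ℝ`, between the strict
epigraph of `Φ` and the points lying below `inf VP - penalty f` over `L f`. Since `Φ` is finite and
continuous, no constraint qualification is needed, and the slope of the separating affine function
is a dual minimizer.

Convexity of the dual is that of a supremum of affine functions; strictness comes from the
conjugates of differentiable `ρ_i` (`conj_strictConvexOn`). Without a duality gap every
Fenchel–Young inequality is an equality, which gives the subgradient relations; strict convexity of
`ρ_i` then makes `ρ_i^*` differentiable (`conj_hasDerivAt`). -/

theorem exists_affine_between {E : Type*} [NormedAddCommGroup E] [NormedSpace ℝ E]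
    {θ : E → ℝ} (hθ : ConvexOn ℝ univ θ) (hc : Continuous θ) {C : Set (E × ℝ)}
    (hC : Convex ℝ C) (hne : C.Nonempty) (hle : ∀ b ∈ C, b.2 ≤ θ b.1) :
    ∃ (g : StrongDual ℝ E) (c : ℝ), (∀ e, g e + c ≤ θ e) ∧ ∀ b ∈ C, b.2 ≤ g b.1 + c := by
  have hA : Convex ℝ {a : E × ℝ | θ a.1 < a.2} := by
    simpa using hθ.convex_strict_epigraph
  have hAo : IsOpen {a : E × ℝ | θ a.1 < a.2} :=
    isOpen_lt (hc.comp continuous_fst) continuous_snd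
  obtain ⟨f, u, h1, h2⟩ := geometric_hahn_banach_open hA hAo hC (by
    rw [Set.disjoint_left]
    intro b hb hb'
    exact absurd (hle b hb') (not_le.2 hb))
  set f1 : StrongDual ℝ E := f.comp (ContinuousLinearMap.inl ℝ E ℝ) with hf1
  set k : ℝ := f (0, 1) with hk
  have hf : ∀ e r, f (e, r) = f1 e + r * k := by
    intro e r
    have : ((e, r) : E × ℝ) = (e, 0) + r • (0, 1) := by simp
    rw [this, map_add, map_smul]
    simp [hf1, hk]
  -- The separating hyperplane is not vertical: `C` has a point over some `e0`, and the epigraph has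
  -- a higher point over the same `e0` because `θ` is finite everywhere.
  have hk0 : k < 0 := by
    obtain ⟨⟨e0, r0⟩, hb⟩ := hne
    have a1 := h1 (e0, θ e0 + 1) (by simp)
    have a2 := h2 _ hb
    have a3 := hle _ hb
    rw [hf] at a1 a2
    simp only at a3
    nlinarith
  -- Solve the hyperplane equation `f1 e + r * k = u` for the height `r`.
  refine ⟨(-k⁻¹) • f1, u * k⁻¹, fun e => ?_, fun b hb => ?_⟩
  · have : f1 e + θ e * k ≤ u := by
      refine le_of_forall_pos_lt_add fun ε hε => ?_
      have := h1 (e, θ e + ε / (-k)) (by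
        have : 0 < ε / (-k) := div_pos hε (by linarith)
        simp [this])
      rw [hf] at this
      have e1 : ε / (-k) * k = -ε := by
        have := hk0.ne
        field_simp
      nlinarith
    have h3 : (u - f1 e) / k ≤ θ e := by
      rw [div_le_iff_of_neg hk0]; linarith
    calc _ = (u - f1 e) / k := by simp; ring
      _ ≤ _ := h3
  · have a2 := h2 _ hb
    rw [show b = (b.1, b.2) from rfl, hf] at a2
    have h3 : b.2 ≤ (u - f1 b.1) / k := by
      rw [le_div_iff_of_neg hk0]; linarith
    calc _ ≤ (u - f1 b.1) / k := h3
      _ = _ := by simp; ring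

theorem iSup_coe_ne_bot {ι : Type*} [Nonempty ι] (a : ι → ℝ) : (⨆ i, (a i : EReal)) ≠ ⊥ := by
  obtain ⟨i⟩ := ‹Nonempty ι›
  exact ne_bot_of_le_ne_bot (EReal.coe_ne_bot (a i)) (le_iSup (fun i => (a i : EReal)) i)

theorem iSup_coe_le {ι : Type*} {a : ι → ℝ} (h : (⨆ i, (a i : EReal)) ≠ ⊤) (i : ι) :
    a i ≤ (⨆ i, (a i : EReal)).toReal := by
  have h1 := (le_iSup (fun i => (a i : EReal)) i).trans (EReal.le_coe_toReal h)
  exact EReal.coe_le_coe_iff.1 h1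

theorem iSup_coe_toReal_le {ι : Type*} [Nonempty ι] {a : ι → ℝ} {r : ℝ} (h : ∀ i, a i ≤ r) :
    (⨆ i, (a i : EReal)) ≠ ⊤ ∧ (⨆ i, (a i : EReal)).toReal ≤ r := by
  have h1 : (⨆ i, (a i : EReal)) ≤ r := iSup_le fun i => EReal.coe_le_coe_iff.2 (h i)
  have h2 : (⨆ i, (a i : EReal)) ≠ ⊤ := ne_top_of_le_ne_top (EReal.coe_ne_top r) h1
  exact ⟨h2, EReal.toReal_le_toReal h1 (iSup_coe_ne_bot a) (EReal.coe_ne_top r)⟩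

theorem convexOn_iSup_coe {E ι : Type*} [AddCommGroup E] [Module ℝ E] [Nonempty ι]
    {a : ι → E → ℝ} (ha : ∀ i, ConvexOn ℝ univ (a i)) :
    ConvexOn ℝ {x | (⨆ i, (a i x : EReal)) ≠ ⊤} (fun x => (⨆ i, (a i x : EReal)).toReal) := by
  have key : ∀ x, (⨆ i, (a i x : EReal)) ≠ ⊤ → ∀ y, (⨆ i, (a i y : EReal)) ≠ ⊤ →
      ∀ s t : ℝ, 0 ≤ s → 0 ≤ t → s + t = 1 → (⨆ i, (a i (s • x + t • y) : EReal)) ≠ ⊤ ∧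
      (⨆ i, (a i (s • x + t • y) : EReal)).toReal ≤
        s • (⨆ i, (a i x : EReal)).toReal + t • (⨆ i, (a i y : EReal)).toReal := by
    intro x hx y hy s t hs ht hst
    refine iSup_coe_toReal_le fun i => ((ha i).2 trivial trivial hs ht hst).trans ?_
    have h1 := iSup_coe_le hx i
    have h2 := iSup_coe_le hy i
    simp only [smul_eq_mul]
    gcongr
  exact ⟨fun x hx y hy s t hs ht hst => (key x hx y hy s t hs ht hst).1,
    fun x hx y hy s t hs ht hst => (key x hx y hy s t hs ht hst).2⟩

/-! ### The Legendre transform on the line -/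

theorem conj_ne_bot (r : ℝ → ℝ) (a : ℝ) : conj r a ≠ ⊥ := iSup_coe_ne_bot _

theorem le_conj {r : ℝ → ℝ} {a : ℝ} (h : conj r a ≠ ⊤) (z : ℝ) :
    a * z - r z ≤ (conj r a).toReal := iSup_coe_le h z

theorem conj_toReal_le {r : ℝ → ℝ} {a c : ℝ} (h : ∀ z, a * z - r z ≤ c) :
    conj r a ≠ ⊤ ∧ (conj r a).toReal ≤ c := iSup_coe_toReal_le h

/-- The affine minorants of `r` with slopes `a < c` and `b > c` make `r w - c * w` coercive at both
ends, so it attains its minimum. -/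
theorem exists_conj_eq {r : ℝ → ℝ} (hr : Continuous r) {a b c : ℝ} (ha : conj r a ≠ ⊤)
    (hb : conj r b ≠ ⊤) (hac : a < c) (hcb : c < b) : ∃ z, ∀ w, c * w - r w ≤ c * z - r z := by
  have hlim : Filter.Tendsto (fun w => r w - c * w) (Filter.cocompact ℝ) Filter.atTop := by
    rw [cocompact_eq_atBot_atTop, Filter.tendsto_sup]
    constructor
    · refine Filter.tendsto_atTop_mono (f := fun w => (a - c) * w - (conj r a).toReal) (fun w => ?_)
        (Filter.tendsto_atTop_add_const_right _ _
          (Filter.tendsto_id.const_mul_atBot_of_neg (by linarith)))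
      linarith [le_conj ha w]
    · refine Filter.tendsto_atTop_mono (f := fun w => (b - c) * w - (conj r b).toReal) (fun w => ?_)
        (Filter.tendsto_atTop_add_const_right _ _
          (Filter.tendsto_id.const_mul_atTop (by linarith)))
      linarith [le_conj hb w]
  obtain ⟨z, hz⟩ := (hr.sub (continuous_const.mul continuous_id)).exists_forall_le hlim
  exact ⟨z, fun w => by have := hz w; simp only [id, Pi.sub_apply, Pi.mul_apply] at this; linarith⟩

theorem deriv_eq_of_conj_eq {r : ℝ → ℝ} (hr : Differentiable ℝ r) {a z : ℝ}
    (h : ∀ w, a * w - r w ≤ a * z - r z) : deriv r z = a := by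
  have h1 : IsLocalMax (fun w => a * w - r w) z := Filter.Eventually.of_forall h
  have h2 : HasDerivAt (fun w => a * w - r w) (a - deriv r z) z := by
    simpa using ((hasDerivAt_id z).const_mul a).fun_sub (hr z).hasDerivAt
  linarith [h1.hasDerivAt_eq_zero h2]

theorem conj_convexOn (r : ℝ → ℝ) :
    ConvexOn ℝ {a | conj r a ≠ ⊤} (fun a => (conj r a).toReal) := by
  refine convexOn_iSup_coe (a := fun z a => a * z - r z) fun z => ⟨convex_univ, ?_⟩
  intro x _ y _ s t hs ht hst
  simp only [smul_eq_mul]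
  nlinarith [hst, congrArg (· * r z) hst]

/-- If convexity were an equality at a point between `x` and `y`, the maximizer `z` there would be a
maximizer for both `x` and `y`, and `deriv r z` would equal both slopes. -/
theorem conj_strictConvexOn {r : ℝ → ℝ} (hr : Differentiable ℝ r) :
    StrictConvexOn ℝ {a | conj r a ≠ ⊤} (fun a => (conj r a).toReal) := by
  refine ⟨(conj_convexOn r).1, ?_⟩
  have key : ∀ x, conj r x ≠ ⊤ → ∀ y, conj r y ≠ ⊤ → x < y → ∀ s t : ℝ, 0 < s → 0 < t →
      s + t = 1 → (conj r (s • x + t • y)).toReal <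
        s • (conj r x).toReal + t • (conj r y).toReal := by
    intro x hx y hy hxy s t hs ht hst
    obtain rfl : s = 1 - t := by linarith
    simp only [smul_eq_mul]
    obtain ⟨z, hz⟩ := exists_conj_eq hr.continuous hx hy (c := (1 - t) * x + t * y)
      (by nlinarith) (by nlinarith)
    refine (conj_toReal_le hz).2.trans_lt ?_
    have hx' := le_conj hx z
    have hy' := le_conj hy z
    by_contra! hcon
    have ex : (conj r x).toReal = x * z - r z := by nlinarith
    have ey : (conj r y).toReal = y * z - r z := by nlinarith
    have e1 := deriv_eq_of_conj_eq hr (a := x) (z := z) fun w => by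
      rw [← ex]; exact le_conj hx w
    have e2 := deriv_eq_of_conj_eq hr (a := y) (z := z) fun w => by
      rw [← ey]; exact le_conj hy w
    linarith
  intro x hx y hy hxy s t hs ht hst
  rcases lt_or_gt_of_ne hxy with h | h
  · exact key x hx y hy h s t hs ht hst
  · have := key y hy x hx h t s ht hs (by linarith)
    rwa [add_comm (s • x), add_comm (s • (conj r x).toReal)]

/-- By strict convexity `w` is the unique maximizer of `a * z - r z`, and near-maximizers for slopes
`b` close to `a` stay close to `w`. So the conjugate exceeds its affine minorant of slope `w` by at
most `ε * |b - a|`. -/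
theorem conj_hasDerivAt {r : ℝ → ℝ} (hr : StrictConvexOn ℝ univ r) {a w : ℝ}
    (h : ∀ z, r w + a * (z - w) ≤ r z) :
    (∀ᶠ b in nhds a, conj r b ≠ ⊤) ∧ HasDerivAt (fun b => (conj r b).toReal) w a := by
  have hstrict : ∀ z, z ≠ w → r w + a * (z - w) < r z := by
    intro z hz
    have h1 := hr.2 (mem_univ z) (mem_univ w) hz (half_pos one_pos) (half_pos one_pos)
      (add_halves (1 : ℝ))
    have h2 := h ((1 / 2 : ℝ) • z + (1 / 2 : ℝ) • w)
    simp only [smul_eq_mul] at h1 h2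
    linarith
  have key : ∀ ε > 0, ∃ δ > 0, ∀ b, |b - a| < δ → ∀ z,
      b * z - r z ≤ a * w - r w + (b - a) * w + ε * |b - a| := by
    intro ε hε
    have hp := hstrict (w + ε) (by linarith)
    have hm := hstrict (w - ε) (by linarith)
    -- `D` is the smaller gap between `r` and its supporting line at `w ± ε`; a change of slope
    -- below `D / ε` cannot close it.
    set D := min (r (w + ε) - (r w + a * ε)) (r (w - ε) - (r w - a * ε)) with hD
    have hD0 : 0 < D := lt_min (by linarith [hp]) (by linarith [hm])
    have hDp : D ≤ r (w + ε) - (r w + a * ε) := min_le_left _ _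
    have hDm : D ≤ r (w - ε) - (r w - a * ε) := min_le_right _ _
    refine ⟨D / ε, by positivity, fun b hb z => ?_⟩
    rw [lt_div_iff₀ hε] at hb
    have hnn : 0 ≤ ε * |b - a| := by positivity
    have hle := abs_le.1 (le_refl |b - a|)
    rcases le_or_gt |z - w| ε with hz | hz
    · have : (b - a) * (z - w) ≤ |b - a| * ε := by
        refine (le_abs_self _).trans ?_
        rw [abs_mul]; gcongr
      nlinarith [h z]
    -- Difference quotients from `w` increase along each ray, so beyond distance `ε` the gap grows
    -- at least in proportion to the distance.
    · have conv : ∀ v : ℝ, ∀ τ : ℝ, 1 < τ → τ * (r (w + v) - r w) ≤ r (w + τ * v) - r w := by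
        intro v τ hτ
        have := hr.convexOn.2 (mem_univ (w + τ * v)) (mem_univ w)
          (show 0 ≤ τ⁻¹ by positivity)
          (show 0 ≤ 1 - τ⁻¹ by rw [sub_nonneg]; exact inv_le_one_of_one_le₀ hτ.le) (by ring)
        have e : τ⁻¹ • (w + τ * v) + (1 - τ⁻¹) • w = w + v := by
          simp only [smul_eq_mul]; field_simp; ring
        rw [e] at this
        simp only [smul_eq_mul] at this
        have h3 := mul_le_mul_of_nonneg_left this (by positivity : 0 ≤ τ)
        have e2 : τ * (τ⁻¹ * r (w + τ * v) + (1 - τ⁻¹) * r w) =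
            r (w + τ * v) + (τ - 1) * r w := by field_simp
        rw [e2] at h3
        linarith
      rcases le_or_gt 0 (z - w) with h0 | h0
      · rw [abs_of_nonneg h0] at hz
        have h4 := conv ε ((z - w) / ε) (by rwa [one_lt_div hε])
        have e : w + (z - w) / ε * ε = z := by field_simp; ring
        rw [e] at h4
        set τ := (z - w) / ε with hτ
        have hτ1 : 1 < τ := by rwa [hτ, one_lt_div hε]
        have hzτ : z - w = τ * ε := by rw [hτ]; field_simp
        have h5 : (b - a) * ε ≤ D := by nlinarith
        have h6 : τ * ((b - a) * ε) ≤ τ * D := by gcongr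
        have h7 : τ * D ≤ τ * (r (w + ε) - (r w + a * ε)) := by gcongr
        have ez : z = w + τ * ε := by linarith
        rw [ez] at h4 ⊢
        nlinarith
      · rw [abs_of_neg h0] at hz
        have h4 := conv (-ε) (-(z - w) / ε) (by rwa [one_lt_div hε])
        have e : w + -(z - w) / ε * -ε = z := by field_simp; ring
        rw [e] at h4
        set τ := -(z - w) / ε with hτ
        have hτ1 : 1 < τ := by rwa [hτ, one_lt_div hε]
        have hzτ : -(z - w) = τ * ε := by rw [hτ]; field_simp
        have h5 : -(b - a) * ε ≤ D := by nlinarith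
        have h6 : τ * (-(b - a) * ε) ≤ τ * D := by gcongr
        have h7 : τ * D ≤ τ * (r (w - ε) - (r w - a * ε)) := by gcongr
        have ez : z = w - τ * ε := by linarith
        rw [← sub_eq_add_neg] at h4
        rw [ez] at h4 ⊢
        nlinarith
  have hfin : ∀ᶠ b in nhds a, conj r b ≠ ⊤ := by
    obtain ⟨δ, hδ, H⟩ := key 1 one_pos
    filter_upwards [Metric.ball_mem_nhds a hδ] with b hb
    exact (conj_toReal_le (H b (by rwa [Metric.mem_ball, Real.dist_eq] at hb))).1
  have ha : (conj r a).toReal = a * w - r w :=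
    le_antisymm (conj_toReal_le fun z => by linarith [h z]).2 (le_conj hfin.self_of_nhds w)
  refine ⟨hfin, ?_⟩
  rw [hasDerivAt_iff_isLittleO, Asymptotics.isLittleO_iff]
  intro ε hε
  obtain ⟨δ, hδ, H⟩ := key ε hε
  filter_upwards [hfin, Metric.ball_mem_nhds a hδ] with b hb hb'
  rw [Metric.mem_ball, Real.dist_eq] at hb'
  have h1 := (conj_toReal_le (H b hb')).2
  have h2 := le_conj hb w
  rw [ha, Real.norm_eq_abs, Real.norm_eq_abs, smul_eq_mul, abs_of_nonneg (by linarith)]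
  linarith

/-! ### Finite sums and separable suprema in the extended reals -/

theorem EReal_coe_finset_sum {ι : Type*} (s : Finset ι) (f : ι → ℝ) :
    ((∑ i ∈ s, f i : ℝ) : EReal) = ∑ i ∈ s, (f i : EReal) := by
  classical
  induction s using Finset.induction_on with
  | empty => simp
  | insert a s ha ih => rw [Finset.sum_insert ha, Finset.sum_insert ha, EReal.coe_add, ih]

theorem EReal_sum_ne_bot {ι : Type*} {s : Finset ι} {f : ι → EReal} (h : ∀ i ∈ s, f i ≠ ⊥) :
    ∑ i ∈ s, f i ≠ ⊥ := by
  classical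
  induction s using Finset.induction_on with
  | empty => simp
  | insert a s ha ih =>
    rw [Finset.sum_insert ha, Ne, EReal.add_eq_bot_iff, not_or]
    exact ⟨h a (Finset.mem_insert_self a s), ih fun i hi => h i (Finset.mem_insert_of_mem hi)⟩

theorem EReal_sum_ne_top_iff {ι : Type*} {s : Finset ι} {f : ι → EReal} (h : ∀ i ∈ s, f i ≠ ⊥) :
    ∑ i ∈ s, f i ≠ ⊤ ↔ ∀ i ∈ s, f i ≠ ⊤ := by
  classical
  induction s using Finset.induction_on with
  | empty => simp
  | insert a s ha ih =>
    have h1 : f a ≠ ⊥ := h a (Finset.mem_insert_self a s)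
    have h2 : ∀ i ∈ s, f i ≠ ⊥ := fun i hi => h i (Finset.mem_insert_of_mem hi)
    rw [Finset.sum_insert ha, EReal.add_ne_top_iff_ne_top₂ h1 (EReal_sum_ne_bot h2), ih h2]
    simp

theorem EReal_toReal_sum {ι : Type*} {s : Finset ι} {f : ι → EReal} (h : ∀ i ∈ s, f i ≠ ⊥)
    (h' : ∀ i ∈ s, f i ≠ ⊤) : (∑ i ∈ s, f i).toReal = ∑ i ∈ s, (f i).toReal := by
  have : ∑ i ∈ s, f i = ((∑ i ∈ s, (f i).toReal : ℝ) : EReal) := by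
    rw [EReal_coe_finset_sum]
    exact Finset.sum_congr rfl fun i hi => (EReal.coe_toReal (h' i hi) (h i hi)).symm
  rw [this, EReal.toReal_coe]

/-- The supremum of a separable function is the sum of the suprema. -/
theorem iSup_sum_eq {ι : Type*} [Fintype ι] (φ : ι → ℝ → ℝ) :
    (⨆ z : ι → ℝ, ((∑ i, φ i (z i) : ℝ) : EReal)) = ∑ i, ⨆ z : ℝ, (φ i z : EReal) := by
  classical
  refine le_antisymm (iSup_le fun z => ?_) ?_
  · rw [EReal_coe_finset_sum]
    exact Finset.sum_le_sum fun i _ => le_iSup (fun z => (φ i z : EReal)) (z i)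
  · by_cases hX : (⨆ z : ι → ℝ, ((∑ i, φ i (z i) : ℝ) : EReal)) = ⊤
    · rw [hX]; exact le_top
    have hb := iSup_coe_le hX
    set X := (⨆ z : ι → ℝ, ((∑ i, φ i (z i) : ℝ) : EReal)).toReal with hXdef
    have hXe : (⨆ z : ι → ℝ, ((∑ i, φ i (z i) : ℝ) : EReal)) = X :=
      (EReal.coe_toReal hX (iSup_coe_ne_bot _)).symm
    rw [hXe]
    -- Freezing the other coordinates at `0` bounds each single supremum by the joint one.
    have hfin : ∀ i, (⨆ z : ℝ, (φ i z : EReal)) ≠ ⊤ := by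
      intro i
      refine (iSup_coe_toReal_le (r := X - ∑ j ∈ Finset.univ.erase i, φ j 0) fun w => ?_).1
      have := hb (Function.update 0 i w)
      rw [← Finset.add_sum_erase _ _ (Finset.mem_univ i)] at this
      rw [Function.update_self] at this
      have e : ∑ j ∈ Finset.univ.erase i, φ j ((Function.update (0 : ι → ℝ) i w) j) =
          ∑ j ∈ Finset.univ.erase i, φ j 0 := by
        refine Finset.sum_congr rfl fun j hj => ?_
        rw [Function.update_of_ne (Finset.ne_of_mem_erase hj)]; rfl
      rw [e] at this
      linarith
    have e : ∑ i, (⨆ z : ℝ, (φ i z : EReal)) =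
        ((∑ i, (⨆ z : ℝ, (φ i z : EReal)).toReal : ℝ) : EReal) := by
      rw [EReal_coe_finset_sum]
      exact Finset.sum_congr rfl fun i _ =>
        (EReal.coe_toReal (hfin i) (iSup_coe_ne_bot _)).symm
    rw [e, EReal.coe_le_coe_iff]
    refine le_of_forall_pos_lt_add fun ε hε => ?_
    -- The `+ 1` keeps the denominator positive for an empty index type and makes the total slack
    -- strictly less than `ε`.
    have hz : ∀ i, ∃ z, (⨆ z : ℝ, (φ i z : EReal)).toReal - ε / (Fintype.card ι + 1) < φ i z := by
      intro i
      by_contra! hcon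
      have := (iSup_coe_toReal_le hcon).2
      have : 0 < ε / (Fintype.card ι + 1) := by positivity
      linarith
    choose z hz using hz
    have h1 : ∑ i, (⨆ z : ℝ, (φ i z : EReal)).toReal ≤
        ∑ i, (φ i (z i) + ε / (Fintype.card ι + 1)) :=
      Finset.sum_le_sum fun i _ => by linarith [hz i]
    rw [Finset.sum_add_distrib, Finset.sum_const, Finset.card_univ, nsmul_eq_mul] at h1
    have h2 : (Fintype.card ι : ℝ) * (ε / (Fintype.card ι + 1)) < ε := by
      rw [mul_div_assoc', div_lt_iff₀ (by positivity)]; nlinarith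
    linarith [hb z]

theorem iSup_shift_eq_conj (r : ℝ → ℝ) (a y : ℝ) :
    (⨆ z : ℝ, ((a * z - r (z - y) : ℝ) : EReal)) = conj r a + ((a * y : ℝ) : EReal) := by
  refine le_antisymm (iSup_le fun z => ?_) ?_
  · have : ((a * z - r (z - y) : ℝ) : EReal) =
        ((a * (z - y) - r (z - y) : ℝ) : EReal) + ((a * y : ℝ) : EReal) := by
      rw [← EReal.coe_add]; congr 1; ring
    rw [this]
    gcongr
    exact le_iSup (fun z => ((a * z - r z : ℝ) : EReal)) (z - y)
  · rw [← EReal.le_sub_iff_add_le (Or.inl (EReal.coe_ne_bot _)) (Or.inl (EReal.coe_ne_top _))]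
    refine iSup_le fun z => ?_
    rw [EReal.le_sub_iff_add_le (Or.inl (EReal.coe_ne_bot _)) (Or.inl (EReal.coe_ne_top _)),
      ← EReal.coe_add]
    refine le_trans (le_of_eq ?_)
      (le_iSup (fun z => ((a * z - r (z - y) : ℝ) : EReal)) (z + y))
    simp only [add_sub_cancel_right]
    congr 1; ring

/-! ### The dual of `L_p` -/

section LpDual

variable {α : Type*} [MeasurableSpace α] {μ : Measure α}

theorem eLpNorm_ofReal {p : ℝ} (hp : 0 < p) {f : α → ℝ} (hf : MemLp f (ENNReal.ofReal p) μ) :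
    eLpNorm f (ENNReal.ofReal p) μ = ENNReal.ofReal ((∫ a, |f a| ^ p ∂μ) ^ (1 / p)) := by
  rw [hf.eLpNorm_eq_integral_rpow_norm (by simpa using hp) ENNReal.ofReal_ne_top,
    ENNReal.toReal_ofReal hp.le, one_div]
  rfl

theorem integral_abs_rpow_nonneg (p : ℝ) (f : α → ℝ) : 0 ≤ ∫ a, |f a| ^ p ∂μ :=
  integral_nonneg fun _ => by positivity

theorem norm_toLp_ofReal {p : ℝ} (hp : 0 < p) {f : α → ℝ}
    (hf : MemLp f (ENNReal.ofReal p) μ) :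
    ‖hf.toLp f‖ = (∫ a, |f a| ^ p ∂μ) ^ (1 / p) := by
  rw [Lp.norm_toLp, eLpNorm_ofReal hp hf,
    ENNReal.toReal_ofReal (Real.rpow_nonneg (integral_abs_rpow_nonneg p f) _)]

theorem integrable_abs_rpow {p : ℝ} (hp : 0 < p) {f : α → ℝ}
    (hf : MemLp f (ENNReal.ofReal p) μ) : Integrable (fun a => |f a| ^ p) μ := by
  have := hf.integrable_norm_rpow (by simpa using hp) ENNReal.ofReal_ne_top
  rwa [ENNReal.toReal_ofReal hp.le] at this

variable [IsFiniteMeasure μ] {P : ENNReal} [Fact (1 ≤ P)]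

/-- The error after a finite partial sum is the indicator of the remaining sets, whose measure is a
tail of a convergent series. For `P ≠ ⊤` small measure forces small norm. -/
theorem hasSum_indicatorConstLp (hP : P ≠ ⊤) {f : ℕ → Set α} (hf : ∀ i, MeasurableSet (f i))
    (hd : Pairwise (Function.onFun Disjoint f)) :
    HasSum (fun i => indicatorConstLp P (hf i) (measure_ne_top μ (f i)) (1 : ℝ))
      (indicatorConstLp P (MeasurableSet.iUnion hf) (measure_ne_top μ _) 1) := by
  classical
  have hm : ∀ S : Finset ℕ, MeasurableSet (⋃ i ∈ S, f i) := fun S =>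
    Finset.measurableSet_biUnion _ fun i _ => hf i
  have hsum : ∀ S : Finset ℕ,
      indicatorConstLp P (hm S) (measure_ne_top μ _) (1 : ℝ) =
        ∑ i ∈ S, indicatorConstLp P (hf i) (measure_ne_top μ (f i)) (1 : ℝ) := by
    intro S
    induction S using Finset.induction_on with
    | empty => simp
    | insert a S ha ih =>
      rw [Finset.sum_insert ha, ← ih, ← indicatorConstLp_disjoint_union (hf a) (hm S)]
      · congr 1
        simp
      · simp only [disjoint_iUnion_right]
        intro i hi
        exact hd fun h => ha (h ▸ hi)
  unfold HasSum
  simp only [SummationFilter.unconditional_filter]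
  simp_rw [← hsum]
  refine tendsto_indicatorConstLp_set hP ?_
  have h1 : ∑' i, μ (f i) ≠ ⊤ := by
    rw [← measure_iUnion hd hf]; exact measure_ne_top μ _
  have h2 := ENNReal.tendsto_tsum_compl_atTop_zero h1
  refine tendsto_of_tendsto_of_tendsto_of_le_of_le tendsto_const_nhds h2 (fun _ => zero_le)
    fun S => ?_
  refine (measure_mono (t := ⋃ i : {i // i ∉ S}, f i) ?_).trans (measure_iUnion_le _)
  intro x hx
  simp only [mem_symmDiff, mem_iUnion] at hx ⊢
  rcases hx with ⟨⟨i, _, hi⟩, h⟩ | ⟨⟨i, hi⟩, h⟩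
  · exact absurd ⟨i, hi⟩ h
  · exact ⟨⟨i, fun hS => h ⟨i, hS, hi⟩⟩, hi⟩

open Classical in
/-- The signed measure `A ↦ Λ 1_A` of a continuous functional on `L_p`. -/
noncomputable def dualMeasure (hP : P ≠ ⊤) (Λ : StrongDual ℝ (Lp ℝ P μ)) : SignedMeasure α where
  measureOf' A := if h : MeasurableSet A then Λ (indicatorConstLp P h (measure_ne_top μ A) 1) else 0
  empty' := by simp
  not_measurable' A hA := by simp [hA]
  m_iUnion' f hf hd := by
    simp only [hf, MeasurableSet.iUnion hf, dite_true]
    exact Λ.hasSum (hasSum_indicatorConstLp hP hf hd)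

theorem dualMeasure_apply (hP : P ≠ ⊤) (Λ : StrongDual ℝ (Lp ℝ P μ)) {A : Set α}
    (hA : MeasurableSet A) :
    dualMeasure hP Λ A = Λ (indicatorConstLp P hA (measure_ne_top μ A) 1) := by
  simp [dualMeasure, hA]

/-- Radon–Nikodym for `dualMeasure`: it is absolutely continuous because the indicator of a null set
is zero in `L_p`. -/
theorem exists_density (hP : P ≠ ⊤) (Λ : StrongDual ℝ (Lp ℝ P μ)) :
    ∃ g : α → ℝ, Measurable g ∧ Integrable g μ ∧ ∀ A, ∀ hA : MeasurableSet A,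
      Λ (indicatorConstLp P hA (measure_ne_top μ A) 1) = ∫ x in A, g x ∂μ := by
  refine ⟨(dualMeasure hP Λ).rnDeriv μ, SignedMeasure.measurable_rnDeriv _ _,
    SignedMeasure.integrable_rnDeriv _ _, fun A hA => ?_⟩
  rw [← dualMeasure_apply hP Λ hA, ← withDensityᵥ_apply (SignedMeasure.integrable_rnDeriv _ _) hA,
    SignedMeasure.withDensityᵥ_rnDeriv_eq]
  refine VectorMeasure.AbsolutelyContinuous.mk fun B hB h0 => ?_
  rw [Measure.toENNRealVectorMeasure_apply_measurable hB] at h0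
  rw [dualMeasure_apply hP Λ hB]
  have : indicatorConstLp P hB (measure_ne_top μ B) (1 : ℝ) = 0 := by
    rw [← norm_eq_zero, norm_indicatorConstLp
      (one_pos.trans_le (Fact.out : 1 ≤ P)).ne' hP, measureReal_def, h0]
    have : P.toReal ≠ 0 :=
      (ENNReal.toReal_pos (one_pos.trans_le (Fact.out : 1 ≤ P)).ne' hP).ne'
    simp [this]
  rw [this, map_zero]

theorem dual_simpleFunc {g : α → ℝ} (hg : Integrable g μ) (Λ : StrongDual ℝ (Lp ℝ P μ))
    (h : ∀ A, ∀ hA : MeasurableSet A,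
      Λ (indicatorConstLp P hA (measure_ne_top μ A) 1) = ∫ x in A, g x ∂μ)
    (s : SimpleFunc α ℝ) :
    Λ ((s.memLp_of_isFiniteMeasure P μ).toLp s) = ∫ x, s x * g x ∂μ := by
  have hint : ∀ s : SimpleFunc α ℝ, Integrable (fun x => s x * g x) μ := by
    intro s
    obtain ⟨C, hC⟩ := s.exists_forall_norm_le
    exact hg.bdd_mul s.aestronglyMeasurable (Filter.Eventually.of_forall hC)
  induction s using SimpleFunc.induction with
  | const c hA =>
    rename_i A
    have e : ((SimpleFunc.piecewise A hA (SimpleFunc.const α c)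
        (SimpleFunc.const α 0)).memLp_of_isFiniteMeasure P μ).toLp _ =
        c • indicatorConstLp P hA (measure_ne_top μ A) (1 : ℝ) := by
      rw [indicatorConstLp, ← MemLp.toLp_const_smul]
      congr 1
      ext x
      by_cases hx : x ∈ A <;> simp [hx]
    rw [e, map_smul, h, smul_eq_mul, ← integral_const_mul, ← integral_indicator hA]
    congr 1
    ext x
    by_cases hx : x ∈ A <;> simp [hx]
  | add hd h1 h2 =>
    rename_i f f'
    have e : ((f + f').memLp_of_isFiniteMeasure P μ).toLp _ =
        (f.memLp_of_isFiniteMeasure P μ).toLp _ + (f'.memLp_of_isFiniteMeasure P μ).toLp _ := by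
      rw [← MemLp.toLp_add]; rfl
    rw [e, map_add, h1, h2, ← integral_add (hint f) (hint f')]
    congr 1
    ext x
    simp [add_mul]

end LpDual

/-- Testing `Λ` on `sign(g) |s_n|^(q-1)`, with `s_n` simple functions tending to `g`, bounds the
`L_q` norms of `s_n` by `2 * ‖Λ‖`; Fatou's lemma passes this to `g`. -/
theorem memLp_density {α : Type*} [MeasurableSpace α] {μ : Measure α} [IsFiniteMeasure μ]
    {p q : ℝ} (hpq : p.HolderConjugate q) [Fact (1 ≤ ENNReal.ofReal p)] {g : α → ℝ}
    (hgm : Measurable g) (hg : Integrable g μ) (Λ : StrongDual ℝ (Lp ℝ (ENNReal.ofReal p) μ))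
    (h : ∀ s : SimpleFunc α ℝ,
      Λ ((s.memLp_of_isFiniteMeasure (ENNReal.ofReal p) μ).toLp s) = ∫ x, s x * g x ∂μ) :
    MemLp g (ENNReal.ofReal q) μ := by
  have hp0 := hpq.pos
  have hq0 := hpq.symm.pos
  have hq1 := hpq.symm.lt
  set s : ℕ → SimpleFunc α ℝ := fun n => SimpleFunc.approxOn g hgm univ 0 trivial n with hs
  set σ : SimpleFunc α ℝ := SimpleFunc.piecewise {x | 0 ≤ g x}
    (measurableSet_le measurable_const hgm) (SimpleFunc.const α 1) (SimpleFunc.const α (-1)) with hσ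
  have hσg : ∀ x, σ x * g x = |g x| := by
    intro x
    by_cases hx : 0 ≤ g x
    · simp [hσ, hx, abs_of_nonneg hx]
    · simp [hσ, hx, abs_of_neg (not_le.1 hx)]
  have hσ1 : ∀ x, |σ x| = 1 := by
    intro x
    by_cases hx : 0 ≤ g x <;> simp [hσ, hx]
  have hI : ∀ n, (∫ x, |s n x| ^ q ∂μ) ^ (1 / q) ≤ 2 * ‖Λ‖ := by
    intro n
    set I := ∫ x, |s n x| ^ q ∂μ with hIdef
    have hI0 : 0 ≤ I := integral_abs_rpow_nonneg q _
    set φ : SimpleFunc α ℝ := σ * (s n).map (fun v => |v| ^ (q - 1)) with hφ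
    have hφx : ∀ x, φ x = σ x * |s n x| ^ (q - 1) := fun x => rfl
    have hφp : ∀ x, |φ x| ^ p = |s n x| ^ q := by
      intro x
      rw [hφx, abs_mul, hσ1, one_mul, abs_of_nonneg (by positivity),
        ← Real.rpow_mul (abs_nonneg _)]
      congr 1
      exact hpq.symm.sub_one_mul_conj
    have hφg : ∀ x, |s n x| ^ q ≤ 2 * (φ x * g x) := by
      intro x
      -- The factor `2` comes from the norm bound for `SimpleFunc.approxOn`.
      have h1 : |s n x| ≤ 2 * |g x| := by
        have := SimpleFunc.norm_approxOn_zero_le hgm (s := univ) trivial x n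
        simp only [Real.norm_eq_abs] at this
        linarith
      have h2 : |s n x| ^ q = |s n x| ^ (q - 1) * |s n x| := by
        rcases eq_or_ne (s n x) 0 with h0 | h0
        · rw [h0]; simp [hq0.ne']
        · rw [← Real.rpow_add_one (abs_ne_zero.2 h0)]; congr 1; ring
      rw [h2, hφx, mul_right_comm, hσg]
      nlinarith [Real.rpow_nonneg (abs_nonneg (s n x)) (q - 1)]
    have hΛ := h φ
    have hint : Integrable (fun x => φ x * g x) μ := by
      obtain ⟨C, hC⟩ := φ.exists_forall_norm_le
      exact hg.bdd_mul φ.aestronglyMeasurable (Filter.Eventually.of_forall hC)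
    have h1 : I ≤ 2 * ∫ x, φ x * g x ∂μ := by
      rw [← integral_const_mul]
      exact integral_mono
        (integrable_abs_rpow hq0 ((s n).memLp_of_isFiniteMeasure (ENNReal.ofReal q) μ))
        (hint.const_mul 2) hφg
    have h2 := (le_abs_self _).trans (Λ.le_opNorm
      ((φ.memLp_of_isFiniteMeasure (ENNReal.ofReal p) μ).toLp φ))
    rw [norm_toLp_ofReal hp0, hΛ] at h2
    simp_rw [hφp] at h2
    rw [← hIdef] at h2
    have h3 : I ≤ 2 * ‖Λ‖ * I ^ (1 / p) := by linarith
    rcases hI0.eq_or_lt with h0 | h0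
    · rw [← h0, Real.zero_rpow (by positivity)]; positivity
    -- Dividing `I ≤ 2 * ‖Λ‖ * I ^ (1 / p)` by `I ^ (1 / p)` leaves `I ^ (1 / q)`.
    · have h4 : I = I ^ (1 / q) * I ^ (1 / p) := by
        rw [← Real.rpow_add h0]
        have := hpq.symm.inv_add_inv_eq_one
        simp only [one_div, this, Real.rpow_one]
      have h5 : 0 < I ^ (1 / p) := Real.rpow_pos_of_pos h0 _
      rw [h4] at h3
      have h6 : (I ^ (1 / q) * I ^ (1 / p)) ^ (1 / p) = I ^ (1 / p) := by rw [← h4]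
      rw [h6] at h3
      exact le_of_mul_le_mul_right h3 h5
  refine ⟨hgm.aestronglyMeasurable, ?_⟩
  refine (Lp.eLpNorm_lim_le_liminf_eLpNorm (fun n => (s n).aestronglyMeasurable) g
    (Filter.Eventually.of_forall fun x =>
      SimpleFunc.tendsto_approxOn hgm (mem_univ 0) (by simp))).trans_lt ?_
  refine lt_of_le_of_lt (b := ENNReal.ofReal (2 * ‖Λ‖)) ?_ ENNReal.ofReal_lt_top
  refine Filter.liminf_le_of_le (by isBoundedDefault) fun b hb => ?_
  obtain ⟨n, hn⟩ := hb.exists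
  refine hn.trans ?_
  rw [eLpNorm_ofReal hq0 ((s n).memLp_of_isFiniteMeasure (ENNReal.ofReal q) μ)]
  exact ENNReal.ofReal_le_ofReal (hI n)

theorem integrable_mul_of_memLp {α : Type*} [MeasurableSpace α] {μ : Measure α}
    {p q : ℝ} (hpq : p.HolderConjugate q) {f g : α → ℝ} (hf : MemLp f (ENNReal.ofReal p) μ)
    (hg : MemLp g (ENNReal.ofReal q) μ) : Integrable (fun x => f x * g x) μ := by
  have : (ENNReal.ofReal p).HolderConjugate (ENNReal.ofReal q) := hpq.ennrealOfReal
  exact hf.integrable_mul hg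

/-- Every continuous functional on `L_p` is integration against a function in `L_q`. -/
theorem exists_lp_dual {α : Type*} [MeasurableSpace α] {μ : Measure α} [IsFiniteMeasure μ]
    {p q : ℝ} (hpq : p.HolderConjugate q) [Fact (1 ≤ ENNReal.ofReal p)]
    (Λ : StrongDual ℝ (Lp ℝ (ENNReal.ofReal p) μ)) :
    ∃ g : α → ℝ, MemLp g (ENNReal.ofReal q) μ ∧ ∀ φ, Λ φ = ∫ x, φ x * g x ∂μ := by
  obtain ⟨g, hgm, hgi, hg⟩ := exists_density ENNReal.ofReal_ne_top Λ
  have hs := dual_simpleFunc hgi Λ hg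
  have hgq := memLp_density hpq hgm hgi Λ hs
  refine ⟨g, hgq, fun φ => ?_⟩
  have : Fact (1 ≤ ENNReal.ofReal q) := ⟨by
    rw [ENNReal.one_le_ofReal]; exact hpq.symm.lt.le⟩
  have : (ENNReal.ofReal q).HolderConjugate (ENNReal.ofReal p) := hpq.symm.ennrealOfReal
  let M := (ContinuousLinearMap.mul ℝ ℝ).lpPairing μ (ENNReal.ofReal q) (ENNReal.ofReal p)
    (hgq.toLp g)
  have hM : ∀ ψ, M ψ = ∫ x, ψ x * g x ∂μ := by
    intro ψ
    rw [ContinuousLinearMap.lpPairing_eq_integral]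
    refine integral_congr_ae ?_
    filter_upwards [hgq.coeFn_toLp] with x hx
    simp [hx, mul_comm]
  rw [← hM]
  -- Both functionals are continuous and agree on indicators, whose span is dense.
  refine Lp.induction ENNReal.ofReal_ne_top (motive := fun φ => Λ φ = M φ) ?_ ?_ ?_ φ
  · intro c A hA hμ
    have e := hs (SimpleFunc.piecewise A hA (SimpleFunc.const α c) (SimpleFunc.const α 0))
    have e2 : ((SimpleFunc.piecewise A hA (SimpleFunc.const α c)
        (SimpleFunc.const α 0)).memLp_of_isFiniteMeasure (ENNReal.ofReal p) μ).toLp _ =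
        (Lp.simpleFunc.indicatorConst (ENNReal.ofReal p) hA hμ.ne c : Lp ℝ _ μ) := by
      rw [Lp.simpleFunc.coe_indicatorConst, indicatorConstLp]
      congr 1
    rw [e2] at e
    rw [e, hM]
    refine integral_congr_ae ?_
    rw [Lp.simpleFunc.coe_indicatorConst]
    filter_upwards [indicatorConstLp_coeFn (p := ENNReal.ofReal p) (hs := hA) (hμs := hμ.ne)
      (c := c)] with x hx
    rw [hx]
    simp [Set.piecewise, Set.indicator]
  · intro f g hf hg' hd h1 h2
    rw [map_add, map_add, h1, h2]
  · exact isClosed_eq Λ.continuous M.continuous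

/-! ### Functions in the Sobolev space and their Taylor data -/

/-- Lebesgue measure on `[0,1]`. -/
noncomputable abbrev unitMeasure : Measure ℝ := volume.restrict (Icc (0 : ℝ) 1)

theorem intervalIntegral_eq_unitMeasure (f : ℝ → ℝ) :
    ∫ s in (0 : ℝ)..1, f s = ∫ s, f s ∂unitMeasure := by
  rw [intervalIntegral.integral_of_le zero_le_one, integral_Icc_eq_integral_Ioc]

theorem der_zero_apply (f : unitInterval → ℝ) (t : unitInterval) : der 0 f t = f t := by
  simp [der]

theorem deriv_der {j : ℕ} {f : unitInterval → ℝ} {t : ℝ} (ht : t ∈ Ioo (0 : ℝ) 1) :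
    deriv (der j f) t = der (j + 1) f t := by
  rw [der_succ, derivWithin_of_mem_nhds (Icc_mem_nhds ht.1 ht.2)]

theorem MemW.ac {m : ℕ} {p : ℝ} {f : unitInterval → ℝ} (hf : MemW m p f) {j : ℕ} (hj : j < m)
    (t : unitInterval) : AbsolutelyContinuousOnInterval (der j f) 0 t := by
  refine (hf.2.1 j hj).mono ?_
  rw [uIcc_of_le t.2.1, uIcc_of_le zero_le_one]
  exact Icc_subset_Icc_right t.2.2

/-- Induction by parts with the primitive `-(t-u)^(k+1)/(k+1)!`: its boundary term vanishes at `t`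
and gives the next Taylor term at `0`. The remainder uses `deriv`, as in integration by parts for
absolutely continuous functions; it agrees with `der (k + 1) f` inside the interval. -/
theorem taylor_aux {n : ℕ} {p : ℝ} {f : unitInterval → ℝ} (hf : MemW (n + 1) p f)
    (t : unitInterval) {k : ℕ} (hk : k ≤ n) :
    f t = ∑ j ∈ Finset.range (k + 1), der j f 0 * ((t : ℝ) ^ j / j.factorial) +
      ∫ u in (0 : ℝ)..t, deriv (der k f) u * (((t : ℝ) - u) ^ k / k.factorial) := by
  induction k with
  | zero =>
    have := (hf.ac (Nat.succ_pos n) t).integral_deriv_eq_sub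
    simp only [Nat.zero_add, Finset.sum_range_one, pow_zero, Nat.factorial_zero, Nat.cast_one,
      div_one, mul_one, this]
    rw [der_zero_apply f t]; ring
  | succ k ih =>
    rw [ih (by omega), Finset.sum_range_succ _ (k + 1), add_assoc]
    congr 1
    have hd : ∀ u, HasDerivAt (fun u => -(((t : ℝ) - u) ^ (k + 1) / (k + 1).factorial))
        (((t : ℝ) - u) ^ k / k.factorial) u := by
      intro u
      have h1 := (((hasDerivAt_id u).const_sub (t : ℝ)).pow (k + 1)).div_const
        ((k + 1).factorial : ℝ)
      have h2 := h1.neg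
      refine h2.congr_deriv ?_
      have h1 : ((k : ℝ) + 1) ≠ 0 := by positivity
      have h2 : (k.factorial : ℝ) ≠ 0 := by positivity
      rw [Nat.factorial_succ]
      push_cast
      simp only [id]
      field_simp
    have hac : AbsolutelyContinuousOnInterval
        (fun u => -(((t : ℝ) - u) ^ (k + 1) / (k + 1).factorial)) 0 t := by
      refine ContDiffOn.absolutelyContinuousOnInterval ?_
      fun_prop
    have hip := (hf.ac (j := k + 1) (by omega) t).integral_mul_deriv_eq_deriv_mul hac
    have e1 : ∫ u in (0 : ℝ)..t, deriv (der k f) u * (((t : ℝ) - u) ^ k / k.factorial) =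
        ∫ u in (0 : ℝ)..t, der (k + 1) f u *
          deriv (fun u => -(((t : ℝ) - u) ^ (k + 1) / (k + 1).factorial)) u := by
      refine intervalIntegral.integral_congr_uIoo fun u hu => ?_
      rw [uIoo_of_le t.2.1] at hu
      simp only [(hd u).deriv]
      rw [deriv_der ⟨hu.1, hu.2.trans_le t.2.2⟩]
    rw [e1, hip]
    simp only [sub_self, sub_zero, mul_neg, intervalIntegral.integral_neg]
    simp

/-- Truncating the power moves the limit `t` into the integrand, so that all remainders are
integrals against one fixed measure. -/
theorem setIntegral_tpow_mul (n : ℕ) (t : unitInterval) (g : ℝ → ℝ) :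
    ∫ u in (0 : ℝ)..t, g u * (((t : ℝ) - u) ^ n / n.factorial) =
      ∫ u, tpow n ((t : ℝ) - u) * g u ∂unitMeasure := by
  rw [intervalIntegral.integral_of_le t.2.1, integral_Ioc_eq_integral_Ioo]
  have h2 : Ioo (0 : ℝ) t ⊆ Icc 0 1 := fun u hu => ⟨hu.1.le, hu.2.le.trans t.2.2⟩
  have h4 : ∫ u in Icc (0 : ℝ) 1, tpow n ((t : ℝ) - u) * g u =
      ∫ u in Ioc (0 : ℝ) 1, tpow n ((t : ℝ) - u) * g u := integral_Icc_eq_integral_Ioc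
  have h3 : ∫ u in Ioc (0 : ℝ) 1, tpow n ((t : ℝ) - u) * g u =
      ∫ u in Ioo (0 : ℝ) t, tpow n ((t : ℝ) - u) * g u := by
    refine setIntegral_eq_of_subset_of_forall_sdiff_eq_zero measurableSet_Ioc
      (fun u hu => ⟨hu.1, hu.2.le.trans t.2.2⟩) fun u hu => ?_
    have : ¬ u < t := fun h => hu.2 ⟨hu.1.1, h⟩
    simp [tpow, this]
  rw [h4, h3]
  refine setIntegral_congr_fun measurableSet_Ioo fun u hu => ?_
  simp only [tpow, sub_pos, hu.2, if_true]
  ring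

/-- Taylor's formula in `W_{n+1,p}`. -/
theorem taylor {n : ℕ} {p : ℝ} {f : unitInterval → ℝ} (hf : MemW (n + 1) p f)
    (t : unitInterval) :
    f t = ∑ j ∈ Finset.range (n + 1), der j f 0 * ((t : ℝ) ^ j / j.factorial) +
      ∫ u, tpow n ((t : ℝ) - u) * der (n + 1) f u ∂unitMeasure := by
  rw [taylor_aux hf t le_rfl, ← setIntegral_tpow_mul]
  congr 1
  refine intervalIntegral.integral_congr_uIoo fun u hu => ?_
  rw [uIoo_of_le t.2.1] at hu
  rw [deriv_der ⟨hu.1, hu.2.trans_le t.2.2⟩]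

/-! ### Uniqueness and existence of a function with given Taylor data -/

theorem eq_of_data {n : ℕ} {p q : ℝ} {f g : unitInterval → ℝ} (hf : MemW (n + 1) p f)
    (hg : MemW (n + 1) q g) (h0 : ∀ j < n + 1, der j f 0 = der j g 0)
    (h1 : der (n + 1) f =ᵐ[unitMeasure] der (n + 1) g) : f = g := by
  funext t
  rw [taylor hf t, taylor hg t]
  congr 1
  · exact Finset.sum_congr rfl fun j hj => by rw [h0 j (Finset.mem_range.1 hj)]
  · exact integral_congr_ae (by filter_upwards [h1] with u hu; rw [hu])

/-- Iterated antiderivatives of `φ`, with values `c k` at `0`. -/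
noncomputable def iterPrim (c : ℕ → ℝ) (φ : ℝ → ℝ) : ℕ → ℝ → ℝ
  | 0 => φ
  | k + 1 => fun t => c k + ∫ u in (0 : ℝ)..t, iterPrim c φ k u

theorem iterPrim_continuous (c : ℕ → ℝ) {φ : ℝ → ℝ} (hφ : Integrable φ) (k : ℕ) :
    Continuous (iterPrim c φ (k + 1)) := by
  induction k with
  | zero =>
    exact continuous_const.add (intervalIntegral.continuous_primitive
      (fun a b => hφ.intervalIntegrable) 0)
  | succ k ih =>
    exact continuous_const.add (intervalIntegral.continuous_primitive
      (fun a b => ih.intervalIntegrable a b) 0)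

theorem iterPrim_hasDerivAt (c : ℕ → ℝ) {φ : ℝ → ℝ} (hφ : Integrable φ) (k : ℕ) (s : ℝ) :
    HasDerivAt (iterPrim c φ (k + 2)) (iterPrim c φ (k + 1) s) s := by
  have h := iterPrim_continuous c hφ k
  exact (intervalIntegral.integral_hasDerivAt_right (h.intervalIntegrable 0 s)
    (h.stronglyMeasurableAtFilter _ _) h.continuousAt).const_add (c (k + 1))

theorem exists_of_data {n : ℕ} {p : ℝ} (hp : 1 ≤ p) (c : ℕ → ℝ) {φ : ℝ → ℝ}
    (hφ : MemLp φ (ENNReal.ofReal p) unitMeasure) :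
    ∃ f : W (n + 1) p, (∀ j < n + 1, der j f 0 = c j) ∧
      der (n + 1) f =ᵐ[unitMeasure] φ := by
  set ψ : ℝ → ℝ := (Icc (0 : ℝ) 1).indicator φ with hψ
  have hφi : IntegrableOn φ (Icc (0 : ℝ) 1) :=
    hφ.integrable (by rwa [ENNReal.one_le_ofReal])
  have hψi : Integrable ψ := (integrable_indicator_iff measurableSet_Icc).2 hφi
  -- `iterPrim` counts integrations, so the derivative of order `j` is stage `n + 1 - j`, and the
  -- constant added at stage `k + 1` is the initial value of order `n - k`.
  set d : ℕ → ℝ := fun k => c (n - k) with hd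
  set G : ℕ → ℝ → ℝ := fun j => iterPrim d ψ (n + 1 - j) with hG
  have hder : ∀ j, j < n → ∀ s, HasDerivAt (G j) (G (j + 1) s) s := by
    intro j hj s
    obtain ⟨k, rfl⟩ : ∃ k, n = j + 1 + k := ⟨n - (j + 1), by omega⟩
    have e1 : j + 1 + k + 1 - j = k + 2 := by omega
    have e2 : j + 1 + k + 1 - (j + 1) = k + 1 := by omega
    simp only [hG, e1, e2]
    exact iterPrim_hasDerivAt d hψi k s
  have hGn : G n = fun t => d 0 + ∫ u in (0 : ℝ)..t, ψ u := by
    have e : n + 1 - n = 0 + 1 := by omega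
    simp only [hG, e]
    rfl
  have hG0 : ∀ j < n + 1, G j 0 = c j := by
    intro j hj
    have e : n + 1 - j = (n - j) + 1 := by omega
    have e2 : n - (n - j) = j := by omega
    simp only [hG, e, iterPrim, intervalIntegral.integral_same, add_zero, hd, e2]
  have hGac : AbsolutelyContinuousOnInterval (G n) 0 1 := by
    rw [hGn]
    have h1 := hψi.intervalIntegrable (a := 0) (b := 1)
    have h2 := h1.absolutelyContinuousOnInterval_intervalIntegral (c := 0) (by simp)
    exact ((contDiffOn_const (n := 1) (c := d 0)).absolutelyContinuousOnInterval).add h2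
  -- Lebesgue differentiation: the primitive of an integrable function has that function as
  -- derivative almost everywhere.
  have hGd : derivWithin (G n) (Icc 0 1) =ᵐ[unitMeasure] φ := by
    have h1 := LocallyIntegrable.ae_hasDerivAt_integral hψi.locallyIntegrable
    rw [Filter.EventuallyEq, ae_restrict_iff' measurableSet_Icc]
    filter_upwards [h1] with t ht htI
    rw [hGn, (((ht 0).const_add (d 0)).hasDerivWithinAt).derivWithin
      (uniqueDiffOn_Icc zero_lt_one t htI), hψ, indicator_of_mem htI]
  set f : unitInterval → ℝ := fun t => G 0 t with hf
  have key : ∀ j, j ≤ n → EqOn (der j f) (G j) (Icc 0 1) := by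
    intro j
    induction j with
    | zero =>
      intro _ t ht
      rw [der, iteratedDerivWithin_zero, IccExtend_of_mem _ f ht]
    | succ j ih =>
      intro hj t ht
      have e := ih (by omega)
      rw [der_succ, derivWithin_congr e (e ht)]
      exact (hder j (by omega) t).hasDerivWithinAt.derivWithin
        (uniqueDiffOn_Icc zero_lt_one t ht)
  have hdiff : ∀ j, j < n → DifferentiableOn ℝ (der j f) (Icc 0 1) := fun j hj =>
    DifferentiableOn.congr
      (fun t _ => (hder j hj t).differentiableAt.differentiableWithinAt) (key j hj.le)
  have htop : der (n + 1) f =ᵐ[unitMeasure] φ := by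
    refine Filter.EventuallyEq.trans ?_ hGd
    rw [Filter.EventuallyEq, ae_restrict_iff' measurableSet_Icc]
    refine Filter.Eventually.of_forall fun t ht => ?_
    rw [der_succ, derivWithin_congr (key n le_rfl) (key n le_rfl ht)]
  refine ⟨⟨f, fun j hj => hdiff j (by omega), fun j hj => ?_, hφ.ae_eq htop.symm⟩,
    fun j hj => ?_, htop⟩
  · refine ac_congr ?_ (key j (by omega)).symm
    rcases Nat.lt_or_ge j n with h | h
    · have hcont : Continuous (G (j + 1)) := by
        have e : n + 1 - (j + 1) = (n - (j + 1)) + 1 := by omega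
        simp only [hG, e]
        exact iterPrim_continuous d hψi _
      have : ContDiff ℝ 1 (G j) := by
        rw [contDiff_one_iff_deriv]
        refine ⟨fun s => (hder j h s).differentiableAt, ?_⟩
        rwa [show deriv (G j) = G (j + 1) from funext fun s => (hder j h s).deriv]
      exact this.contDiffOn.absolutelyContinuousOnInterval
    · have : j = n := by omega
      subst this
      exact hGac
  · rw [key j (by omega) (by simp), hG0 j hj]

/-! ### Taylor data and the reproducing property of the kernel -/

theorem memLp_tpow (n : ℕ) (p : ℝ) (t : unitInterval) :
    MemLp (fun u => tpow n ((t : ℝ) - u)) (ENNReal.ofReal p) unitMeasure := by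
  refine MemLp.of_bound
    ((tpow_measurable n).comp (measurable_const.sub measurable_id)).aestronglyMeasurable 1 ?_
  rw [ae_restrict_iff' measurableSet_Icc]
  refine Filter.Eventually.of_forall fun u hu => ?_
  have := tpow_abs_le n zero_le_one (r := (t : ℝ) - u)
    (abs_le.2 ⟨by linarith [t.2.1, hu.2], by linarith [t.2.2, hu.1]⟩)
  simpa using this

/-- The function built from these data equals the kernel by Taylor's formula, so the kernel's
integral need not be differentiated. -/
theorem kernelR_data {n : ℕ} {p : ℝ} (hp : 1 ≤ p) (t : unitInterval) :
    (∀ j < n + 1, der j (kernelR (n + 1) t) 0 = (t : ℝ) ^ j / j.factorial) ∧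
      der (n + 1) (kernelR (n + 1) t) =ᵐ[unitMeasure] fun u => tpow n ((t : ℝ) - u) := by
  obtain ⟨f, h0, h1⟩ := exists_of_data (n := n) hp (fun j => (t : ℝ) ^ j / j.factorial)
    (memLp_tpow n p t)
  have e : (f : unitInterval → ℝ) = kernelR (n + 1) t := by
    funext s
    rw [taylor f.2 s, kernelR_eq]
    congr 1
    · exact Finset.sum_congr rfl fun j hj => by rw [h0 j (Finset.mem_range.1 hj)]
    · unfold conv
      rw [← integral_Icc_eq_integral_Ioc]
      refine integral_congr_ae ?_
      filter_upwards [h1] with u hu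
      rw [hu, mul_comm]
  rw [← e]
  exact ⟨h0, h1⟩

/-- The reproducing property of the kernel. -/
theorem pairing_kernelElt {m : ℕ} (hm : 1 ≤ m) {p q : ℝ} (hp : 1 ≤ p) (h : W m q)
    (t : unitInterval) : pairing h (kernelElt hm p t) = (h : unitInterval → ℝ) t := by
  obtain ⟨n, rfl⟩ : ∃ n, m = n + 1 := ⟨m - 1, by omega⟩
  obtain ⟨h0, h1⟩ := kernelR_data (n := n) hp t
  rw [taylor h.2 t, pairing, intervalIntegral_eq_unitMeasure]
  congr 1
  · exact Finset.sum_congr rfl fun j hj => by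
      rw [← h0 j (Finset.mem_range.1 hj)]; rfl
  · refine integral_congr_ae ?_
    filter_upwards [h1] with u hu
    rw [← hu]; rfl

/-! ### The Sobolev space as `ℝ^m × L_p` -/

theorem W_der_add_zero {m : ℕ} {p : ℝ} (f g : W m p) {j : ℕ} (hj : j < m) :
    der j (f + g : W m p) 0 = der j f 0 + der j g 0 := by
  obtain ⟨n, rfl⟩ : ∃ n, m = n + 1 := ⟨m - 1, by omega⟩
  exact (der_add f.2 g.2 (by omega) (by simp)).symm

theorem W_der_top_add {m : ℕ} (hm : 1 ≤ m) {p : ℝ} (f g : W m p) :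
    der m (f + g : W m p) =ᵐ[unitMeasure] der m f + der m g := by
  obtain ⟨n, rfl⟩ : ∃ n, m = n + 1 := ⟨m - 1, by omega⟩
  exact (der_top_add f.2 g.2).symm

theorem W_der_smul {m : ℕ} {p : ℝ} (c : ℝ) (f : W m p) (j : ℕ) (t : ℝ) :
    der j (c • f : W m p) t = c * der j f t := congrFun (der_smul c j f) t

/-- The Taylor data of a function in `W_{m,p}`. -/
noncomputable def toData {m : ℕ} (hm : 1 ≤ m) (p : ℝ) :
    W m p →ₗ[ℝ] (Fin m → ℝ) × Lp ℝ (ENNReal.ofReal p) unitMeasure where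
  toFun f := (fun j => der j f 0, f.2.2.2.toLp (der m f))
  map_add' f g := by
    refine Prod.ext (funext fun j => W_der_add_zero f g j.2) ?_
    simp only [Prod.snd_add]
    rw [← MemLp.toLp_add, MemLp.toLp_eq_toLp_iff]
    exact W_der_top_add hm f g
  map_smul' c f := by
    refine Prod.ext (funext fun j => W_der_smul c f j 0) ?_
    simp only [RingHom.id_apply, Prod.smul_snd]
    rw [← MemLp.toLp_const_smul, MemLp.toLp_eq_toLp_iff]
    exact Filter.Eventually.of_forall fun t => W_der_smul c f m t

theorem toData_bijective {m : ℕ} (hm : 1 ≤ m) {p : ℝ} (hp : 1 ≤ p) :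
    Function.Bijective (toData hm p) := by
  obtain ⟨n, rfl⟩ : ∃ n, m = n + 1 := ⟨m - 1, by omega⟩
  refine ⟨fun f g hfg => ?_, fun ⟨c, φ⟩ => ?_⟩
  · have h := Prod.ext_iff.1 hfg
    refine Subtype.ext (eq_of_data f.2 g.2 (fun j hj => congrFun h.1 ⟨j, hj⟩) ?_)
    exact (MemLp.toLp_eq_toLp_iff f.2.2.2 g.2.2.2).1 h.2
  · obtain ⟨f, h0, h1⟩ := exists_of_data (n := n) hp
      (fun j => if h : j < n + 1 then c ⟨j, h⟩ else 0) (Lp.memLp φ)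
    refine ⟨f, Prod.ext (funext fun j => ?_) ?_⟩
    · have := h0 j j.2
      simp only [j.2, dite_true] at this
      exact this
    · refine Lp.ext ?_
      exact (MemLp.coeFn_toLp f.2.2.2).trans h1

/-- `W_{m,p}` is isomorphic to `ℝ^m × L_p`. -/
noncomputable def dataEquiv {m : ℕ} (hm : 1 ≤ m) {p : ℝ} (hp : 1 ≤ p) :
    W m p ≃ₗ[ℝ] (Fin m → ℝ) × Lp ℝ (ENNReal.ofReal p) unitMeasure :=
  LinearEquiv.ofBijective (toData hm p) (toData_bijective hm hp)

/-- The product carries the maximum norm, so each of the `m + 1` terms of `wNorm` is at most `‖e‖ ^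
p`. This makes bounded functionals continuous in the coordinates. -/
theorem wNorm_le {m : ℕ} (hm : 1 ≤ m) {p : ℝ} (hp : 1 ≤ p) (f : W m p)
    [Fact (1 ≤ ENNReal.ofReal p)] :
    wNorm f ≤ ((m : ℝ) + 1) ^ (1 / p) * ‖dataEquiv hm hp f‖ := by
  have hp0 : 0 < p := by linarith
  set e := dataEquiv hm hp f with he
  have h1 : ∀ j : Fin m, |der j f 0| ≤ ‖e‖ := fun j =>
    (norm_le_pi_norm e.1 j).trans (norm_fst_le e)
  have h2 : ∫ s in (0 : ℝ)..1, |der m f s| ^ p ≤ ‖e‖ ^ p := by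
    have h3 : ‖f.2.2.2.toLp (der m f)‖ ≤ ‖e‖ := norm_snd_le e
    rw [norm_toLp_ofReal hp0] at h3
    rw [intervalIntegral_eq_unitMeasure]
    have h4 := integral_abs_rpow_nonneg (μ := unitMeasure) p (der m f)
    calc _ = ((∫ s, |der m f s| ^ p ∂unitMeasure) ^ (1 / p)) ^ p := by
          rw [← Real.rpow_mul h4, one_div, inv_mul_cancel₀ hp0.ne', Real.rpow_one]
      _ ≤ _ := by gcongr
  have h5 : ∑ j ∈ Finset.range m, |der j f 0| ^ p ≤ m * ‖e‖ ^ p := by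
    calc _ ≤ ∑ j ∈ Finset.range m, ‖e‖ ^ p := by
          refine Finset.sum_le_sum fun j hj => ?_
          have := h1 ⟨j, Finset.mem_range.1 hj⟩
          gcongr
      _ = _ := by simp
  have h6 : 0 ≤ ∑ j ∈ Finset.range m, |der j f 0| ^ p :=
    Finset.sum_nonneg fun j _ => by positivity
  have h7 : 0 ≤ ∫ s in (0 : ℝ)..1, |der m f s| ^ p := by
    rw [intervalIntegral_eq_unitMeasure]; exact integral_abs_rpow_nonneg p _
  calc wNorm f ≤ (((m : ℝ) + 1) * ‖e‖ ^ p) ^ (1 / p) := by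
        unfold wNorm
        gcongr
        linarith
    _ = _ := by
        rw [Real.mul_rpow (by positivity) (by positivity), ← Real.rpow_mul (norm_nonneg e),
          mul_one_div_cancel hp0.ne', Real.rpow_one]

theorem IsBoundedFunctional.exists_strongDual {m : ℕ} (hm : 1 ≤ m) {p : ℝ} (hp : 1 ≤ p)
    [Fact (1 ≤ ENNReal.ofReal p)] {L : W m p →ₗ[ℝ] ℝ} (hL : IsBoundedFunctional L) :
    ∃ G : StrongDual ℝ ((Fin m → ℝ) × Lp ℝ (ENNReal.ofReal p) unitMeasure),
      ∀ f, G (dataEquiv hm hp f) = L f := by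
  obtain ⟨C, hC⟩ := hL
  refine ⟨(L ∘ₗ (dataEquiv hm hp).symm.toLinearMap).mkContinuous
    (|C| * ((m : ℝ) + 1) ^ (1 / p)) fun e => ?_, fun f => by simp⟩
  obtain ⟨f, rfl⟩ := (dataEquiv hm hp).surjective e
  simp only [LinearMap.comp_apply, LinearEquiv.coe_coe, LinearEquiv.symm_apply_apply]
  have h0 : 0 ≤ wNorm f := by
    unfold wNorm
    rw [intervalIntegral_eq_unitMeasure]
    have := integral_abs_rpow_nonneg (μ := unitMeasure) p (der m f)
    have : 0 ≤ ∑ j ∈ Finset.range m, |der j f 0| ^ p :=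
      Finset.sum_nonneg fun j _ => by positivity
    positivity
  calc ‖L f‖ ≤ C * wNorm f := hC f
    _ ≤ |C| * wNorm f := by gcongr; exact le_abs_self C
    _ ≤ |C| * (((m : ℝ) + 1) ^ (1 / p) * ‖dataEquiv hm hp f‖) := by
        gcongr; exact wNorm_le hm hp f
    _ = _ := by ring

/-- The dual of `W_{m,p}` is `W_{m,q}`. -/
theorem exists_pairing_eq {m : ℕ} (hm : 1 ≤ m) {p q : ℝ} (hpq : p.HolderConjugate q)
    [Fact (1 ≤ ENNReal.ofReal p)]
    (G : StrongDual ℝ ((Fin m → ℝ) × Lp ℝ (ENNReal.ofReal p) unitMeasure)) :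
    ∃ h : W m q, ∀ f, G (dataEquiv hm hpq.lt.le f) = pairing h f := by
  -- The restriction of `G` to the `L_p` factor prescribes the top derivative of `h`; its values on
  -- the coordinate vectors prescribe the initial values.
  obtain ⟨g, hg, hG⟩ := exists_lp_dual hpq
    (G.comp (ContinuousLinearMap.inr ℝ (Fin m → ℝ) (Lp ℝ (ENNReal.ofReal p) unitMeasure)))
  obtain ⟨n, rfl⟩ : ∃ n, m = n + 1 := ⟨m - 1, by omega⟩
  obtain ⟨h, h0, h1⟩ := exists_of_data (n := n) hpq.symm.lt.le
    (fun j => if h : j < n + 1 then G (Pi.single ⟨j, h⟩ 1, 0) else 0) hg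
  refine ⟨h, fun f => ?_⟩
  set e := dataEquiv hm hpq.lt.le f with he
  have h2 : G e = G (e.1, 0) + G (0, e.2) := by rw [← map_add]; simp
  have h3 : G (e.1, 0) = ∑ j : Fin (n + 1), e.1 j * G (Pi.single j 1, 0) := by
    have : ((e.1, 0) : (Fin (n + 1) → ℝ) × Lp ℝ (ENNReal.ofReal p) unitMeasure) =
        ∑ j : Fin (n + 1), e.1 j • (Pi.single j 1, 0) := by
      refine Prod.ext ?_ ?_
      · rw [Prod.fst_sum]
        simp only [Prod.smul_mk]
        exact pi_eq_sum_univ' e.1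
      · rw [Prod.snd_sum]; simp
    rw [this, map_sum]
    exact Finset.sum_congr rfl fun j _ => by rw [map_smul, smul_eq_mul]
  have h4 : G (0, e.2) = ∫ s, der (n + 1) f s * der (n + 1) h s ∂unitMeasure := by
    have := hG e.2
    simp only [ContinuousLinearMap.comp_apply, ContinuousLinearMap.inr_apply] at this
    rw [this]
    refine integral_congr_ae ?_
    have h5 : (e.2 : ℝ → ℝ) =ᵐ[unitMeasure] der (n + 1) f := MemLp.coeFn_toLp f.2.2.2
    filter_upwards [h5, h1] with s hs hs'
    rw [hs, hs']
  rw [h2, h3, h4, pairing, intervalIntegral_eq_unitMeasure, Finset.sum_range]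
  congr 1
  refine Finset.sum_congr rfl fun j _ => ?_
  rw [h0 j j.2, mul_comm]
  simp only [j.2, dite_true]
  rfl

/-! ### The energy of the dual projection -/

theorem convexOn_norm_snd_rpow {E F : Type*} [NormedAddCommGroup E] [NormedSpace ℝ E]
    [NormedAddCommGroup F] [NormedSpace ℝ F] {p : ℝ} (hp : 1 ≤ p) :
    ConvexOn ℝ univ (fun e : E × F => ‖e.2‖ ^ p) := by
  refine ⟨convex_univ, fun x _ y _ s t hs ht hst => ?_⟩
  have h1 : ‖(s • x + t • y).2‖ ≤ s • ‖x.2‖ + t • ‖y.2‖ := by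
    refine (norm_add_le _ _).trans (le_of_eq ?_)
    simp [norm_smul, abs_of_nonneg hs, abs_of_nonneg ht]
  calc ‖(s • x + t • y).2‖ ^ p ≤ (s • ‖x.2‖ + t • ‖y.2‖) ^ p := by gcongr
    _ ≤ _ := (convexOn_rpow hp).2 (norm_nonneg _) (norm_nonneg _) hs ht hst

theorem penalty_eq {m : ℕ} (hm : 1 ≤ m) {p : ℝ} (hp : 1 ≤ p) (lam : ℝ) (f : W m p) :
    penalty lam f = lam / p * ‖(dataEquiv hm hp f).2‖ ^ p := by
  have hp0 : 0 < p := by linarith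
  have h1 : ‖(dataEquiv hm hp f).2‖ = _ := norm_toLp_ofReal hp0 f.2.2.2
  rw [h1, ← Real.rpow_mul (integral_abs_rpow_nonneg p _), one_div, inv_mul_cancel₀ hp0.ne',
    Real.rpow_one, penalty, intervalIntegral_eq_unitMeasure]

theorem penalty_convexOn {m : ℕ} (hm : 1 ≤ m) {p : ℝ} (hp : 1 ≤ p) {lam : ℝ} (hlam : 0 < lam) :
    ConvexOn ℝ univ (penalty lam : W m p → ℝ) := by
  have : Fact (1 ≤ ENNReal.ofReal p) := ⟨by rwa [ENNReal.one_le_ofReal]⟩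
  have h := ((convexOn_norm_snd_rpow (E := Fin m → ℝ)
    (F := Lp ℝ (ENNReal.ofReal p) unitMeasure) hp).smul
      (show 0 ≤ lam / p by positivity)).comp_linearMap (dataEquiv hm hp).toLinearMap
  refine h.congr fun f _ => ?_
  rw [penalty_eq hm hp]
  rfl

theorem lintegral_enorm_rpow {α : Type*} [MeasurableSpace α] {μ : Measure α} {q : ℝ}
    (hq : 0 < q) {u : α → ℝ} (hu : MemLp u (ENNReal.ofReal q) μ) :
    ∫⁻ s, ‖u s‖ₑ ^ q ∂μ = ENNReal.ofReal (∫ s, |u s| ^ q ∂μ) := by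
  rw [ofReal_integral_eq_lintegral_ofReal (integrable_abs_rpow hq hu)
    (Filter.Eventually.of_forall fun s => by positivity)]
  refine lintegral_congr fun s => ?_
  rw [← ENNReal.ofReal_rpow_of_nonneg (abs_nonneg _) hq.le, Real.enorm_eq_ofReal_abs]

/-- Young's inequality for `lam^(1/p) * a` and `lam^(-1/p) * b`; the power of `lam` is `1 - q`
because `q / p = q - 1`. -/
theorem young_lam {p q : ℝ} (hpq : p.HolderConjugate q) {lam : ℝ} (hlam : 0 < lam) (a b : ℝ) :
    a * b ≤ lam / p * |a| ^ p + lam ^ (1 - q) / q * |b| ^ q := by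
  have h := Real.young_inequality (lam ^ (1 / p) * a) (lam ^ (-(1 / p)) * b) hpq
  have e1 : lam ^ (1 / p) * a * (lam ^ (-(1 / p)) * b) = a * b := by
    rw [mul_mul_mul_comm, ← Real.rpow_add hlam, add_neg_cancel, Real.rpow_zero, one_mul]
  have e2 : |lam ^ (1 / p) * a| ^ p = lam * |a| ^ p := by
    rw [abs_mul, abs_of_pos (Real.rpow_pos_of_pos hlam _), Real.mul_rpow (by positivity)
      (abs_nonneg a), ← Real.rpow_mul hlam.le, one_div, inv_mul_cancel₀ hpq.ne_zero,
      Real.rpow_one]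
  have e3 : |lam ^ (-(1 / p)) * b| ^ q = lam ^ (1 - q) * |b| ^ q := by
    rw [abs_mul, abs_of_pos (Real.rpow_pos_of_pos hlam _), Real.mul_rpow (by positivity)
      (abs_nonneg b), ← Real.rpow_mul hlam.le]
    congr 2
    have := hpq.symm.div_conj_eq_sub_one
    rw [neg_mul, one_div_mul_eq_div, this]
    ring
  rw [e1, e2, e3] at h
  calc _ ≤ _ := h
    _ = _ := by ring

/-- The extremal function in Young's inequality. -/
theorem exists_young_eq {α : Type*} [MeasurableSpace α] {μ : Measure α} {p q : ℝ}
    (hpq : p.HolderConjugate q) {lam : ℝ} (hlam : 0 < lam) {u : α → ℝ}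
    (hu : MemLp u (ENNReal.ofReal q) μ) :
    ∃ φ : α → ℝ, MemLp φ (ENNReal.ofReal p) μ ∧
      ∫ s, φ s * u s ∂μ - lam / p * ∫ s, |φ s| ^ p ∂μ =
        lam ^ (1 - q) / q * ∫ s, |u s| ^ q ∂μ := by
  have hp0 := hpq.pos
  have hq0 := hpq.symm.pos
  have hq1 := hpq.symm.lt
  -- The pointwise maximizer of `a * u - (lam / p) * |a|^p`, namely `lam^(1-q) sign(u) |u|^(q-1)`.
  -- Where `u` vanishes the factor `u s` makes it zero, even if `q < 2`.
  set φ : α → ℝ := fun s => lam ^ (1 - q) * (u s * |u s| ^ (q - 2)) with hφ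
  have hlq : 0 < lam ^ (1 - q) := Real.rpow_pos_of_pos hlam _
  have h1 : ∀ s, φ s * u s = lam ^ (1 - q) * |u s| ^ q := by
    intro s
    rcases eq_or_ne (u s) 0 with h0 | h0
    · simp [hφ, h0, hq0.ne']
    · have e : |u s| ^ q = |u s| ^ (q - 2) * |u s| ^ 2 := by
        rw [← Real.rpow_natCast, ← Real.rpow_add (abs_pos.2 h0)]
        congr 1; push_cast; ring
      rw [e, sq_abs, hφ]
      ring
  have h2 : ∀ s, |φ s| ^ p = lam ^ (-q) * |u s| ^ q := by
    intro s
    have e0 : |φ s| = lam ^ (1 - q) * |u s| ^ (q - 1) := by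
      change |lam ^ (1 - q) * (u s * |u s| ^ (q - 2))| = _
      rw [abs_mul, abs_of_pos hlq, abs_mul,
        abs_of_nonneg (Real.rpow_nonneg (abs_nonneg (u s)) (q - 2))]
      congr 1
      rcases eq_or_ne (u s) 0 with h0 | h0
      · rw [h0, abs_zero, zero_mul, Real.zero_rpow (by linarith)]
      · rw [mul_comm, ← Real.rpow_add_one (abs_ne_zero.2 h0)]
        congr 1; ring
    have e1 : (q - 1) * p = q := hpq.symm.sub_one_mul_conj
    rw [e0, Real.mul_rpow hlq.le (by positivity), ← Real.rpow_mul hlam.le,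
      ← Real.rpow_mul (abs_nonneg _), e1]
    congr 2
    linarith
  have hm : AEStronglyMeasurable φ μ := by
    have := hu.1.aemeasurable
    refine AEMeasurable.aestronglyMeasurable ?_
    fun_prop
  refine ⟨φ, ?_, ?_⟩
  · rw [← integrable_norm_rpow_iff hm (by simpa using hp0) ENNReal.ofReal_ne_top,
      ENNReal.toReal_ofReal hp0.le]
    refine Integrable.congr ((integrable_abs_rpow hq0 hu).const_mul (lam ^ (-q)))
      (Filter.Eventually.of_forall fun s => ?_)
    exact (h2 s).symm
  · simp_rw [h1, h2]
    rw [integral_const_mul, integral_const_mul]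
    have e : lam * lam ^ (-q) = lam ^ (1 - q) := by
      rw [sub_eq_add_neg, Real.rpow_add hlam, Real.rpow_one]
    have e2 : 1 - 1 / p = 1 / q := by
      have := hpq.inv_add_inv_eq_one
      simp only [one_div]; linarith
    calc _ = lam ^ (1 - q) * (∫ s, |u s| ^ q ∂μ) -
          lam * lam ^ (-q) / p * ∫ s, |u s| ^ q ∂μ := by ring
      _ = lam ^ (1 - q) * (1 - 1 / p) * ∫ s, |u s| ^ q ∂μ := by rw [e]; ring
      _ = _ := by rw [e2]; ring

theorem pairing_sub {m : ℕ} {p q : ℝ} (hpq : p.HolderConjugate q) (g g' : W m q) (f : W m p) :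
    pairing g f - pairing g' f =
      ∑ j ∈ Finset.range m, (der j g 0 - der j g' 0) * der j f 0 +
        ∫ s, der m f s * (der m g s - der m g' s) ∂unitMeasure := by
  have h1 := integrable_mul_of_memLp hpq f.2.2.2 g.2.2.2
  have h2 := integrable_mul_of_memLp hpq f.2.2.2 g'.2.2.2
  simp only [pairing, intervalIntegral_eq_unitMeasure, mul_sub, sub_mul]
  rw [integral_sub h1 h2, Finset.sum_sub_distrib]
  ring

section Projection

variable {m : ℕ} (hm : 1 ≤ m) {p q : ℝ} (hpq : p.HolderConjugate q) {lam : ℝ} (hlam : 0 < lam)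

/-- `-Bα` represents the functional `-∑ α_i L_i`. -/
theorem exists_representer {N : ℕ} {L : Fin N → W m p →ₗ[ℝ] ℝ}
    (hL : ∀ i, IsBoundedFunctional (L i)) (hpq : p.HolderConjugate q) (α : Fin N → ℝ) :
    ∃ g : W m q, (g : unitInterval → ℝ) = -B hm L α ∧
      ∀ f, pairing g f = -∑ i, α i * L i f := by
  have : Fact (1 ≤ ENNReal.ofReal p) := ⟨by rw [ENNReal.one_le_ofReal]; exact hpq.lt.le⟩
  choose G hG using fun i => (hL i).exists_strongDual hm hpq.lt.le
  obtain ⟨g, hg⟩ := exists_pairing_eq hm hpq (-∑ i, α i • G i)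
  have hg' : ∀ f, pairing g f = -∑ i, α i * L i f := by
    intro f
    rw [← hg f]
    simp [hG]
  refine ⟨g, funext fun t => ?_, hg'⟩
  -- Testing the representer on `R_t` reads off its value at `t`.
  rw [← pairing_kernelElt hm hpq.lt.le g t, hg', Pi.neg_apply, B]
  congr 1
  exact Finset.sum_congr rfl fun i _ => mul_comm _ _

include hpq hlam in
-- Polarity allows subtracting `pairing g' f ≤ 0`, equal initial values cancel the sum, and Young's
-- inequality bounds the integral that remains.
theorem pairing_sub_penalty_le {V : Set (W m p)} {g g' : W m q} (hg' : g' ∈ negPolar q V)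
    (h0 : ∀ j < m, der j g 0 = der j g' 0) {f : W m p} (hf : f ∈ V) :
    pairing g f - penalty lam f ≤
      lam ^ (1 - q) / q * ∫ s, |der m g s - der m g' s| ^ q ∂unitMeasure := by
  have hu : MemLp (fun s => der m g s - der m g' s) (ENNReal.ofReal q) unitMeasure :=
    g.2.2.2.sub g'.2.2.2
  have h1 := pairing_sub hpq g g' f
  have h2 : ∑ j ∈ Finset.range m, (der j g 0 - der j g' 0) * der j f 0 = 0 :=
    Finset.sum_eq_zero fun j hj => by rw [h0 j (Finset.mem_range.1 hj), sub_self, zero_mul]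
  have h3 := hg' f hf
  have i1 := integrable_abs_rpow hpq.pos f.2.2.2
  have i2 := integrable_abs_rpow hpq.symm.pos hu
  have h4 : ∫ s, der m f s * (der m g s - der m g' s) ∂unitMeasure ≤
      ∫ s, (lam / p * |der m f s| ^ p +
        lam ^ (1 - q) / q * |der m g s - der m g' s| ^ q) ∂unitMeasure :=
    integral_mono (integrable_mul_of_memLp hpq f.2.2.2 hu)
      ((i1.const_mul _).add (i2.const_mul _)) fun s => young_lam hpq hlam _ _
  rw [integral_add (i1.const_mul _) (i2.const_mul _), integral_const_mul,
    integral_const_mul] at h4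
  rw [penalty, intervalIntegral_eq_unitMeasure]
  linarith

include hm hpq hlam in
/-- Existence of the dual projection: if `⟨⟨g,f⟩⟩ - penalty f` is bounded by `s` on the cone `V`,
then some `g'` in the polar cone with the initial values of `g` has energy at most `s`. -/
theorem exists_negPolar {V : Set (W m p)} (hV0 : 0 ∈ V)
    (hVadd : ∀ f ∈ V, ∀ f' ∈ V, f + f' ∈ V) (hVsmul : ∀ c : ℝ, 0 ≤ c → ∀ f ∈ V, c • f ∈ V)
    (g : W m q) {s : ℝ} (hs : ∀ f ∈ V, pairing g f - penalty lam f ≤ s) :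
    ∃ g' ∈ negPolar q V, (∀ j < m, der j g 0 = der j g' 0) ∧
      lam ^ (1 - q) / q * ∫ s, |der m g s - der m g' s| ^ q ∂unitMeasure ≤ s := by
  have hp1 := hpq.lt.le
  have hp0 := hpq.pos
  have : Fact (1 ≤ ENNReal.ofReal p) := ⟨by rw [ENNReal.one_le_ofReal]; exact hp1⟩
  have : Fact (1 ≤ ENNReal.ofReal q) := ⟨by rw [ENNReal.one_le_ofReal]; exact hpq.symm.lt.le⟩
  set Ψ := dataEquiv hm hp1 with hΨ
  obtain ⟨G, hG⟩ : ∃ G : StrongDual ℝ ((Fin m → ℝ) × Lp ℝ (ENNReal.ofReal p) unitMeasure),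
      ∀ f, G (Ψ f) = pairing g f := by
    have hq' : (ENNReal.ofReal q).HolderConjugate (ENNReal.ofReal p) := hpq.symm.ennrealOfReal
    let M := (ContinuousLinearMap.mul ℝ ℝ).lpPairing unitMeasure (ENNReal.ofReal q)
      (ENNReal.ofReal p) (g.2.2.2.toLp (der m g))
    let G1 : StrongDual ℝ (Fin m → ℝ) :=
      ∑ j : Fin m, (der j g 0) • ContinuousLinearMap.proj j
    refine ⟨G1.coprod M, fun f => ?_⟩
    rw [ContinuousLinearMap.coprod_apply, pairing, intervalIntegral_eq_unitMeasure,
      Finset.sum_range]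
    congr 1
    · simp only [G1, _root_.sum_apply]
      rfl
    · rw [ContinuousLinearMap.lpPairing_eq_integral]
      refine integral_congr_ae ?_
      have h1 : ((Ψ f).2 : ℝ → ℝ) =ᵐ[unitMeasure] der m f := MemLp.coeFn_toLp f.2.2.2
      filter_upwards [g.2.2.2.coeFn_toLp, h1] with x hx hx'
      rw [hx, hx', ContinuousLinearMap.mul_apply', mul_comm]
  -- In coordinates `θ` is `penalty - pairing g + s`, nonnegative on `V` by `hs`. An affine function
  -- is placed between `θ` and the zero function on `V`.
  set θ : (Fin m → ℝ) × Lp ℝ (ENNReal.ofReal p) unitMeasure → ℝ :=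
    fun e => (lam / p) • ‖e.2‖ ^ p + (-G e + s) with hθdef
  have hθ : ConvexOn ℝ univ θ := by
    refine ((convexOn_norm_snd_rpow hp1).smul (show 0 ≤ lam / p by positivity)).add ?_
    exact ((-G).toLinearMap.convexOn convex_univ).add_const s
  have hθc : Continuous θ := by
    have : Continuous fun e : (Fin m → ℝ) × Lp ℝ (ENNReal.ofReal p) unitMeasure => ‖e.2‖ ^ p :=
      (continuous_norm.comp continuous_snd).rpow_const fun _ => Or.inr hp0.le
    exact (continuous_const.mul this).add (G.continuous.neg.add continuous_const)
  have hθΨ : ∀ f, θ (Ψ f) = penalty lam f - pairing g f + s := by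
    intro f
    rw [penalty_eq hm hp1, ← hG]
    simp only [hθdef, smul_eq_mul]
    ring
  set C : Set (((Fin m → ℝ) × Lp ℝ (ENNReal.ofReal p) unitMeasure) × ℝ) :=
    {b | Ψ.symm b.1 ∈ V ∧ b.2 ≤ 0} with hC
  obtain ⟨k, c, hk1, hk2⟩ := exists_affine_between hθ hθc (C := C)
    (fun x hx y hy a b ha hb hab => by
      refine ⟨?_, ?_⟩
      · simp only [Prod.fst_add, Prod.smul_fst, map_add, map_smul]
        exact hVadd _ (hVsmul a ha _ hx.1) _ (hVsmul b hb _ hy.1)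
      · have h1 := hx.2
        have h2 := hy.2
        simp only [Prod.snd_add, Prod.smul_snd, smul_eq_mul]
        nlinarith)
    ⟨(0, 0), by simpa [hC] using hV0⟩
    (fun b hb => by
      refine hb.2.trans ?_
      obtain ⟨f, hf⟩ := Ψ.surjective b.1
      have h1 := hb.1
      rw [← hf, LinearEquiv.symm_apply_apply] at h1
      rw [← hf, hθΨ]
      linarith [hs f h1])
  have hkV : ∀ f ∈ V, 0 ≤ k (Ψ f) + c := fun f hf =>
    hk2 (Ψ f, 0) ⟨by simpa using hf, le_rfl⟩
  have hc : 0 ≤ c := by simpa using hkV 0 hV0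
  -- Scaling within the cone would let a negative value of `k` outweigh `c`. Hence `-k` is in the
  -- polar cone, and its representer is the required `g'`.
  have hkpos : ∀ f ∈ V, 0 ≤ k (Ψ f) := by
    intro f hf
    by_contra! hneg
    have h1 := hkV _ (hVsmul ((c + 1) / -k (Ψ f))
      (div_nonneg (by linarith) (by linarith)) f hf)
    rw [map_smul, map_smul, smul_eq_mul] at h1
    have h2 : (c + 1) / -k (Ψ f) * k (Ψ f) = -(c + 1) := by
      have := hneg.ne
      field_simp
    linarith
  obtain ⟨g', hg'⟩ := exists_pairing_eq hm hpq (-k)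
  have hmain : ∀ f : W m p, pairing g f - pairing g' f ≤ s + penalty lam f := by
    intro f
    have h1 := hk1 (Ψ f)
    have h2 := hg' f
    rw [← hΨ] at h2
    rw [hθΨ] at h1
    simp only [_root_.neg_apply] at h2
    linarith
  have hinit : ∀ j < m, der j g 0 = der j g' 0 := by
    intro j hj
    -- Test on polynomials of degree below `m`: their penalty vanishes, so a linear function of `τ`
    -- is bounded above and must have slope zero.
    have h1 : ∀ τ : ℝ, τ * (der j g 0 - der j g' 0) ≤ s := by
      intro τ
      obtain ⟨f, hf⟩ := Ψ.surjective (Pi.single ⟨j, hj⟩ τ, 0)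
      have h2 := hmain f
      rw [pairing_sub hpq, penalty_eq hm hp1, ← hΨ, hf] at h2
      have h3 : der m f =ᵐ[unitMeasure] 0 := by
        have a1 : ((Ψ f).2 : ℝ → ℝ) =ᵐ[unitMeasure] der m f := MemLp.coeFn_toLp f.2.2.2
        rw [hf] at a1
        exact a1.symm.trans (Lp.coeFn_zero _ _ _)
      have h4 : ∫ s, der m f s * (der m g s - der m g' s) ∂unitMeasure = 0 := by
        rw [← integral_zero ℝ ℝ (μ := unitMeasure)]
        refine integral_congr_ae ?_
        filter_upwards [h3] with x hx
        rw [hx]; simp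
      have h5 : ∀ i, ∀ hi : i < m, der i f 0 = (Pi.single ⟨j, hj⟩ τ : Fin m → ℝ) ⟨i, hi⟩ :=
        fun i hi => congrFun (congrArg Prod.fst hf) ⟨i, hi⟩
      rw [h4, Finset.sum_eq_single_of_mem j (Finset.mem_range.2 hj), h5 j hj] at h2
      · simp [hp0.ne'] at h2
        linarith
      · intro i hi hij
        rw [h5 i (Finset.mem_range.1 hi), Pi.single_eq_of_ne (by simpa using hij), mul_zero]
    by_contra hne
    have h2 := h1 ((s + 1) / (der j g 0 - der j g' 0))
    rw [div_mul_cancel₀ _ (sub_ne_zero.2 hne)] at h2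
    linarith
  refine ⟨g', fun f hf => ?_, hinit, ?_⟩
  · have h1 := hg' f
    rw [← hΨ, _root_.neg_apply] at h1
    linarith [hkpos f hf]
  · have hu : MemLp (fun s => der m g s - der m g' s) (ENNReal.ofReal q) unitMeasure :=
      g.2.2.2.sub g'.2.2.2
    -- With zero initial values and the Young-extremal function as top derivative, `hmain` becomes
    -- the energy bound.
    obtain ⟨φ, hφ, he⟩ := exists_young_eq hpq hlam hu
    obtain ⟨f, hf⟩ := Ψ.surjective (0, hφ.toLp φ)
    have h2 := hmain f
    have h3 : der m f =ᵐ[unitMeasure] φ := by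
      have a1 : ((Ψ f).2 : ℝ → ℝ) =ᵐ[unitMeasure] der m f := MemLp.coeFn_toLp f.2.2.2
      rw [hf] at a1
      exact a1.symm.trans hφ.coeFn_toLp
    rw [pairing_sub hpq, penalty, intervalIntegral_eq_unitMeasure,
      integral_congr_ae (g := fun s => φ s * (der m g s - der m g' s))
        (by filter_upwards [h3] with x hx; rw [hx]),
      integral_congr_ae (f := fun s => |der m f s| ^ p) (g := fun s => |φ s| ^ p)
        (by filter_upwards [h3] with x hx; rw [hx]),
      Finset.sum_eq_zero fun j hj => by
        rw [hinit j (Finset.mem_range.1 hj), sub_self, zero_mul]] at h2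
    linarith

include hpq hlam in
-- The conjugate of penalty plus indicator of `V` is the infimal convolution of their conjugates.
-- The indicator's conjugate forces `g'` into the polar cone; the penalty's is finite only at zero
-- initial values, whence the constraint at `0`.
theorem mul_projEnergy_eq {V : Set (W m p)} (hV0 : 0 ∈ V)
    (hVadd : ∀ f ∈ V, ∀ f' ∈ V, f + f' ∈ V) (hVsmul : ∀ c : ℝ, 0 ≤ c → ∀ f ∈ V, c • f ∈ V)
    {N : ℕ} {L : Fin N → W m p →ₗ[ℝ] ℝ} (hL : ∀ i, IsBoundedFunctional (L i))
    (α : Fin N → ℝ) :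
    ((lam ^ (1 - q) / q : ℝ) : EReal) * (projEnergy (negPolar q V) (-B hm L α) : EReal) =
      ⨆ f ∈ V, ((-(∑ i, α i * L i f) - penalty lam f : ℝ) : EReal) := by
  obtain ⟨g, hgB, hg⟩ := exists_representer hm hL hpq α
  have hq0 := hpq.symm.pos
  have hc : 0 < lam ^ (1 - q) / q := div_pos (Real.rpow_pos_of_pos hlam _) hq0
  set c := lam ^ (1 - q) / q with hcdef
  -- Testing `f = 0` makes the supremum nonnegative, so it can be compared with the energy in
  -- `ENNReal`.
  have hS0 : 0 ≤ ⨆ f ∈ V, ((-(∑ i, α i * L i f) - penalty lam f : ℝ) : EReal) := by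
    refine le_iSup₂_of_le (0 : W m p) hV0 ?_
    have hd : penalty lam (0 : W m p) = 0 := by
      rw [penalty_eq hm hpq.lt.le]; simp [hpq.ne_zero]
    simp [hd]
  simp_rw [← hg] at hS0 ⊢
  set S := ⨆ f ∈ V, ((pairing g f - penalty lam f : ℝ) : EReal) with hS
  have hcoe : ∀ X : ENNReal, (c : EReal) * (X : EReal) =
      ((ENNReal.ofReal c * X : ENNReal) : EReal) := fun X => by
    rw [EReal.coe_ennreal_mul, EReal.coe_ennreal_ofReal, max_eq_left hc.le]
  have hE : ∀ g' : W m q, ENNReal.ofReal c *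
      ∫⁻ s in Icc (0 : ℝ) 1, ‖der m g s - der m g' s‖ₑ ^ q =
        ENNReal.ofReal (c * ∫ s, |der m g s - der m g' s| ^ q ∂unitMeasure) := by
    intro g'
    have hu : MemLp (fun s => der m g s - der m g' s) (ENNReal.ofReal q) unitMeasure :=
      g.2.2.2.sub g'.2.2.2
    rw [lintegral_enorm_rpow hq0 hu, ENNReal.ofReal_mul hc.le]
  have hr0 : ∀ g' : W m q, 0 ≤ c * ∫ s, |der m g s - der m g' s| ^ q ∂unitMeasure := fun g' =>
    mul_nonneg hc.le (integral_abs_rpow_nonneg q _)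
  rw [hcoe, ← hgB, projEnergy]
  apply le_antisymm
  · by_cases hT : S = ⊤
    · rw [hT]; exact le_top
    have hSr : S = (S.toReal : EReal) :=
      (EReal.coe_toReal hT (ne_bot_of_le_ne_bot (by simp) hS0)).symm
    obtain ⟨g', hg', h0, hle⟩ := exists_negPolar hm hpq hlam hV0 hVadd hVsmul g (s := S.toReal)
      (fun f hf => by
        rw [← EReal.coe_le_coe_iff, ← hSr]
        exact le_iSup₂ (f := fun f (_ : f ∈ V) => ((pairing g f - penalty lam f : ℝ) : EReal)) f hf)
    rw [hSr]
    refine le_trans (b := ((ENNReal.ofReal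
      (c * ∫ s, |der m g s - der m g' s| ^ q ∂unitMeasure) : ENNReal) : EReal)) ?_ ?_
    · rw [EReal.coe_ennreal_le_coe_ennreal_iff, ← hE g']
      gcongr
      exact iInf_le_of_le g' (iInf_le_of_le hg' (iInf_le_of_le h0 le_rfl))
    · rw [EReal.coe_ennreal_ofReal, max_eq_left (hr0 g'), EReal.coe_le_coe_iff]
      exact hle
  · rw [← EReal.coe_toENNReal hS0, EReal.coe_ennreal_le_coe_ennreal_iff]
    have hc0 : ENNReal.ofReal c ≠ 0 := by simpa using hc
    simp_rw [ENNReal.mul_iInf_of_ne hc0 ENNReal.ofReal_ne_top]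
    refine le_iInf fun g' => le_iInf fun hg' => le_iInf fun h0 => ?_
    rw [hE, ← EReal.coe_ennreal_le_coe_ennreal_iff, EReal.coe_toENNReal hS0,
      EReal.coe_ennreal_ofReal, max_eq_left (hr0 g')]
    refine iSup₂_le fun f hf => EReal.coe_le_coe_iff.2 ?_
    exact pairing_sub_penalty_le hpq hlam hg' h0 hf

end Projection

/-! ### The cone of functions with prescribed sign changes -/

theorem node_mem {K : ℕ} {x : Fin K → ℝ} (hx01 : ∀ k, x k ∈ Icc (0 : ℝ) 1) (k : ℕ) :
    node x k ∈ Icc (0 : ℝ) 1 := by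
  rcases k with _ | k
  · simp [node]
  · by_cases h : k < K
    · simpa [node, h] using hx01 ⟨k, h⟩
    · simp [node, h]

theorem Icc_node_subset {K : ℕ} {x : Fin K → ℝ} (hx01 : ∀ k, x k ∈ Icc (0 : ℝ) 1) (k : ℕ) :
    Icc (node x k) (node x (k + 1)) ⊆ Icc 0 1 :=
  Icc_subset_Icc (node_mem hx01 k).1 (node_mem hx01 (k + 1)).2

section Cone

variable {m : ℕ} {p : ℝ} {l K : ℕ} {x : Fin K → ℝ}

theorem coneV_smul {c : ℝ} (hc : 0 ≤ c) {f : W m p} (hf : f ∈ coneV m p l x) :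
    c • f ∈ coneV m p l x := by
  have key : ∀ (k : ℕ) t, 0 ≤ (-1 : ℝ) ^ k * der l f t →
      0 ≤ (-1 : ℝ) ^ k * der l (c • f : W m p) t := by
    intro k t h
    rw [W_der_smul, mul_left_comm]
    exact mul_nonneg hc h
  intro k hk
  refine ⟨fun h t ht => key k t ((hf k hk).1 h t ht), fun h => ?_⟩
  filter_upwards [(hf k hk).2 h] with t ht htI
  exact key k t (ht htI)

theorem coneV_zero : (0 : W m p) ∈ coneV m p l x := by
  have h : ∀ t, der l (0 : W m p) t = 0 := fun t => by
    have := W_der_smul 0 (0 : W m p) l t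
    rwa [zero_smul, zero_mul] at this
  intro k _
  exact ⟨fun _ t _ => by rw [h, mul_zero],
    fun _ => Filter.Eventually.of_forall fun t _ => by rw [h, mul_zero]⟩

/-- Derivatives below order `m` add pointwise on `[0,1]`, those of order `m` only almost everywhere,
just as the cone conditions are stated. -/
theorem coneV_add (hm : 1 ≤ m) (hx01 : ∀ k, x k ∈ Icc (0 : ℝ) 1) {f g : W m p}
    (hf : f ∈ coneV m p l x) (hg : g ∈ coneV m p l x) : f + g ∈ coneV m p l x := by
  obtain ⟨n, rfl⟩ : ∃ n, m = n + 1 := ⟨m - 1, by omega⟩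
  intro k hk
  refine ⟨fun h t ht => ?_, fun h => ?_⟩
  · have e := der_add f.2 g.2 (j := l) (by omega) (Icc_node_subset hx01 k ht)
    have h1 := (hf k hk).1 h t ht
    have h2 := (hg k hk).1 h t ht
    change 0 ≤ (-1 : ℝ) ^ k * der l ((f : unitInterval → ℝ) + g) t
    rw [← e, Pi.add_apply, mul_add]
    exact add_nonneg h1 h2
  · subst h
    have e := der_top_add f.2 g.2
    rw [Filter.EventuallyEq, ae_restrict_iff' measurableSet_Icc] at e
    filter_upwards [e, (hf k hk).2 rfl, (hg k hk).2 rfl] with t ht h1 h2 htI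
    change 0 ≤ (-1 : ℝ) ^ k * der (n + 1) ((f : unitInterval → ℝ) + g) t
    rw [← ht (Icc_node_subset hx01 k htI), Pi.add_apply, mul_add]
    exact add_nonneg (h1 htI) (h2 htI)

end Cone

/-! ### Fenchel duality -/

section Fenchel

variable {m : ℕ} {p lam : ℝ} {N : ℕ} {V : Set (W m p)} {L : Fin N → W m p →ₗ[ℝ] ℝ}
  {ρ : Fin N → ℝ → ℝ} {y : Fin N → ℝ}

theorem iSup_fidelity_eq (ρ : Fin N → ℝ → ℝ) (y α : Fin N → ℝ) :
    (⨆ z : Fin N → ℝ, ((∑ i, α i * z i - ∑ i, ρ i (z i - y i) : ℝ) : EReal)) =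
      ∑ i, (conj (ρ i) (α i) + ((α i * y i : ℝ) : EReal)) := by
  simp_rw [← iSup_shift_eq_conj, ← Finset.sum_sub_distrib]
  exact iSup_sum_eq fun i w => α i * w - ρ i (w - y i)

theorem fenchelDual_eq (α : Fin N → ℝ) :
    fenchelDual lam V L ρ y α =
      (⨆ f : V, ((-(∑ i, α i * L i f) - penalty lam (f : W m p) : ℝ) : EReal)) +
        ∑ i, (conj (ρ i) (α i) + ((α i * y i : ℝ) : EReal)) := by
  rw [fenchelDual, iSup_fidelity_eq, iSup_subtype']

theorem conj_add_ne_bot (r : ℝ → ℝ) (a b : ℝ) : conj r a + ((b : ℝ) : EReal) ≠ ⊥ := by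
  rw [Ne, EReal.add_eq_bot_iff, not_or]
  exact ⟨conj_ne_bot r a, EReal.coe_ne_bot b⟩

theorem fenchelDual_ne_bot (hV : V.Nonempty) (α : Fin N → ℝ) :
    fenchelDual lam V L ρ y α ≠ ⊥ := by
  have : Nonempty V := hV.to_subtype
  rw [fenchelDual_eq, Ne, EReal.add_eq_bot_iff, not_or]
  exact ⟨iSup_coe_ne_bot _, EReal_sum_ne_bot fun i _ => conj_add_ne_bot _ _ _⟩

theorem fenchelDual_ne_top_iff (hV : V.Nonempty) (α : Fin N → ℝ) :
    fenchelDual lam V L ρ y α ≠ ⊤ ↔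
      (⨆ f : V, ((-(∑ i, α i * L i f) - penalty lam (f : W m p) : ℝ) : EReal)) ≠ ⊤ ∧
        ∀ i, conj (ρ i) (α i) ≠ ⊤ := by
  have : Nonempty V := hV.to_subtype
  rw [fenchelDual_eq, EReal.add_ne_top_iff_ne_top₂ (iSup_coe_ne_bot _)
    (EReal_sum_ne_bot fun i _ => conj_add_ne_bot _ _ _),
    EReal_sum_ne_top_iff fun i _ => conj_add_ne_bot _ _ _]
  simp only [Finset.mem_univ, true_implies]
  refine and_congr_right fun _ => forall_congr' fun i => ?_
  rw [EReal.add_ne_top_iff_ne_top₂ (conj_ne_bot _ _) (EReal.coe_ne_bot _)]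
  exact and_iff_left (EReal.coe_ne_top _)

theorem fenchelDual_toReal (hV : V.Nonempty) {α : Fin N → ℝ}
    (h : fenchelDual lam V L ρ y α ≠ ⊤) :
    (fenchelDual lam V L ρ y α).toReal =
      (⨆ f : V, ((-(∑ i, α i * L i f) - penalty lam (f : W m p) : ℝ) : EReal)).toReal +
        ∑ i, ((conj (ρ i) (α i)).toReal + α i * y i) := by
  have : Nonempty V := hV.to_subtype
  have h' := (fenchelDual_ne_top_iff hV α).1 h
  have h2 : ∀ i ∈ Finset.univ, conj (ρ i) (α i) + ((α i * y i : ℝ) : EReal) ≠ ⊤ := fun i _ => by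
    rw [EReal.add_ne_top_iff_ne_top₂ (conj_ne_bot _ _) (EReal.coe_ne_bot _)]
    exact ⟨h'.2 i, EReal.coe_ne_top _⟩
  have h3 : ∀ i ∈ Finset.univ, conj (ρ i) (α i) + ((α i * y i : ℝ) : EReal) ≠ ⊥ :=
    fun i _ => conj_add_ne_bot _ _ _
  rw [fenchelDual_eq, EReal.toReal_add h'.1 (iSup_coe_ne_bot _)
    ((EReal_sum_ne_top_iff h3).2 h2) (EReal_sum_ne_bot h3), EReal_toReal_sum h3 h2]
  congr 1
  refine Finset.sum_congr rfl fun i _ => ?_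
  rw [EReal.toReal_add (h'.2 i) (conj_ne_bot _ _) (EReal.coe_ne_top _) (EReal.coe_ne_bot _),
    EReal.toReal_coe]

theorem iSup_penalty_convexOn (hV : V.Nonempty) :
    ConvexOn ℝ {α : Fin N → ℝ |
        (⨆ f : V, ((-(∑ i, α i * L i f) - penalty lam (f : W m p) : ℝ) : EReal)) ≠ ⊤}
      (fun α => (⨆ f : V,
        ((-(∑ i, α i * L i f) - penalty lam (f : W m p) : ℝ) : EReal)).toReal) := by
  have : Nonempty V := hV.to_subtype
  refine convexOn_iSup_coe
    (a := fun (f : V) (α : Fin N → ℝ) => -(∑ i, α i * L i f) - penalty lam (f : W m p))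
    fun f => ⟨convex_univ, fun α _ β _ s t _ _ hst => le_of_eq ?_⟩
  obtain rfl : t = 1 - s := by linarith
  simp only [Pi.add_apply, Pi.smul_apply, smul_eq_mul, add_mul, Finset.sum_add_distrib,
    mul_assoc, ← Finset.mul_sum]
  ring

theorem fenchelDual_convexOn (hV : V.Nonempty) :
    ConvexOn ℝ {α | fenchelDual lam V L ρ y α ≠ ⊤}
      (fun α => (fenchelDual lam V L ρ y α).toReal) := by
  have hA := iSup_penalty_convexOn (lam := lam) (L := L) hV
  have hdom : Convex ℝ {α | fenchelDual lam V L ρ y α ≠ ⊤} := by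
    intro α hα β hβ s t hs ht hst
    have h1 := (fenchelDual_ne_top_iff hV α).1 hα
    have h2 := (fenchelDual_ne_top_iff hV β).1 hβ
    exact (fenchelDual_ne_top_iff hV _).2 ⟨hA.1 h1.1 h2.1 hs ht hst, fun i =>
      (conj_convexOn (ρ i)).1 (h1.2 i) (h2.2 i) hs ht hst⟩
  refine ⟨hdom, fun α hα β hβ s t hs ht hst => ?_⟩
  have hγ := hdom hα hβ hs ht hst
  have h1 := (fenchelDual_ne_top_iff hV α).1 hα
  have h2 := (fenchelDual_ne_top_iff hV β).1 hβ
  simp only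
  rw [fenchelDual_toReal hV hα, fenchelDual_toReal hV hβ, fenchelDual_toReal hV hγ,
    smul_add, smul_add, add_add_add_comm, Finset.smul_sum, Finset.smul_sum,
    ← Finset.sum_add_distrib]
  refine add_le_add (hA.2 h1.1 h2.1 hs ht hst) (Finset.sum_le_sum fun i _ => ?_)
  have := (conj_convexOn (ρ i)).2 (h1.2 i) (h2.2 i) hs ht hst
  simp only [Pi.add_apply, Pi.smul_apply, smul_eq_mul] at this ⊢
  linarith

/-- Strictness comes from the conjugates alone: distinct arguments differ in some coordinate `i₀`,
and that summand is strictly convex. -/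
theorem fenchelDual_strictConvexOn (hV : V.Nonempty) (hρ : ∀ i, Differentiable ℝ (ρ i)) :
    StrictConvexOn ℝ {α | fenchelDual lam V L ρ y α ≠ ⊤}
      (fun α => (fenchelDual lam V L ρ y α).toReal) := by
  have hA := iSup_penalty_convexOn (lam := lam) (L := L) hV
  have hdom := (fenchelDual_convexOn (lam := lam) (L := L) (ρ := ρ) (y := y) hV).1
  refine ⟨hdom, fun α hα β hβ hne s t hs ht hst => ?_⟩
  have hγ := hdom hα hβ hs.le ht.le hst
  have h1 := (fenchelDual_ne_top_iff hV α).1 hα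
  have h2 := (fenchelDual_ne_top_iff hV β).1 hβ
  simp only
  rw [fenchelDual_toReal hV hα, fenchelDual_toReal hV hβ, fenchelDual_toReal hV hγ,
    smul_add, smul_add, add_add_add_comm, Finset.smul_sum, Finset.smul_sum,
    ← Finset.sum_add_distrib]
  obtain ⟨i₀, hi₀⟩ := Function.ne_iff.1 hne
  refine add_lt_add_of_le_of_lt (hA.2 h1.1 h2.1 hs.le ht.le hst)
    (Finset.sum_lt_sum (fun i _ => ?_) ⟨i₀, Finset.mem_univ _, ?_⟩)
  · have := (conj_convexOn (ρ i)).2 (h1.2 i) (h2.2 i) hs.le ht.le hst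
    simp only [Pi.add_apply, Pi.smul_apply, smul_eq_mul] at this ⊢
    linarith
  · have := (conj_strictConvexOn (hρ i₀)).2 (h1.2 i₀) (h2.2 i₀) hi₀ hs ht hst
    simp only [Pi.add_apply, Pi.smul_apply, smul_eq_mul] at this ⊢
    linarith

/-- With `z = L f` the linear terms of the two suprema cancel. -/
theorem weak_duality {f : W m p} (hf : f ∈ V) (α : Fin N → ℝ) :
    ((-VP lam L ρ y f : ℝ) : EReal) ≤ fenchelDual lam V L ρ y α := by
  have h1 := le_iSup₂ (f := fun f (_ : f ∈ V) =>
    ((-(∑ i, α i * L i f) - penalty lam f : ℝ) : EReal)) f hf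
  have h2 := le_iSup (fun z : Fin N → ℝ =>
    ((∑ i, α i * z i - ∑ i, ρ i (z i - y i) : ℝ) : EReal)) (fun i => L i f)
  have h3 := add_le_add h1 h2
  rw [← EReal.coe_add] at h3
  refine le_trans (le_of_eq ?_) h3
  rw [VP]
  congr 1
  ring

theorem neg_iInf_le_fenchelDual (α : Fin N → ℝ) :
    -(⨅ f ∈ V, (VP lam L ρ y f : EReal)) ≤ fenchelDual lam V L ρ y α := by
  rw [EReal.neg_le]
  refine le_iInf₂ fun f hf => ?_
  rw [EReal.neg_le, ← EReal.coe_neg]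
  exact weak_duality hf α

/-- An affine function below the fidelity term and above `P - penalty f` at each `L f` bounds one
dual supremum by `-c` and the other by `c - P`. The sum `-P` meets weak duality. -/
theorem exists_dual_attaining (hV : V.Nonempty) (hVc : Convex ℝ V)
    (hU : ConvexOn ℝ univ (penalty lam : W m p → ℝ))
    (hρ : ∀ i, ConvexOn ℝ univ (ρ i)) (hρc : ∀ i, Continuous (ρ i)) :
    ∃ α, fenchelDual lam V L ρ y α = -(⨅ f ∈ V, (VP lam L ρ y f : EReal)) := by
  obtain ⟨f₀, hf₀⟩ := hV
  by_cases hbot : (⨅ f ∈ V, (VP lam L ρ y f : EReal)) = ⊥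
  -- If the primal infimum is `-∞`, weak duality makes the dual `⊤` everywhere, so any point will
  -- do.
  · refine ⟨0, le_antisymm ?_ (neg_iInf_le_fenchelDual 0)⟩
    rw [hbot, EReal.neg_bot]
    exact le_top
  have htop : (⨅ f ∈ V, (VP lam L ρ y f : EReal)) ≠ ⊤ :=
    ne_top_of_le_ne_top (EReal.coe_ne_top (VP lam L ρ y f₀)) (iInf₂_le f₀ hf₀)
  obtain ⟨P, hP⟩ : ∃ P : ℝ, (⨅ f ∈ V, (VP lam L ρ y f : EReal)) = P :=
    ⟨_, (EReal.coe_toReal htop hbot).symm⟩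
  have hPle : ∀ f ∈ V, P ≤ VP lam L ρ y f := fun f hf => by
    rw [← EReal.coe_le_coe_iff, ← hP]
    exact iInf₂_le f hf
  have hθ : ConvexOn ℝ univ (fun z : Fin N → ℝ => ∑ i, ρ i (z i - y i)) := by
    refine ⟨convex_univ, fun z _ w _ s t hs ht hst => ?_⟩
    simp only [Finset.smul_sum]
    rw [← Finset.sum_add_distrib]
    refine Finset.sum_le_sum fun i _ => ?_
    have h1 := (hρ i).2 (mem_univ (z i - y i)) (mem_univ (w i - y i)) hs ht hst
    obtain rfl : t = 1 - s := by linarith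
    refine le_trans (le_of_eq ?_) h1
    congr 1
    simp only [Pi.add_apply, Pi.smul_apply, smul_eq_mul]
    ring
  have hθc : Continuous (fun z : Fin N → ℝ => ∑ i, ρ i (z i - y i)) :=
    continuous_finsetSum _ fun i _ =>
      (hρc i).comp ((continuous_apply i).sub continuous_const)
  obtain ⟨g, c, hg1, hg2⟩ := exists_affine_between hθ hθc
    (C := {b | ∃ f ∈ V, b.1 = (fun i => L i f) ∧ b.2 ≤ P - penalty lam f})
    (by
      rintro x ⟨f, hf, hx1, hx2⟩ z ⟨f', hf', hz1, hz2⟩ s t hs ht hst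
      refine ⟨s • f + t • f', hVc hf hf' hs ht hst, ?_, ?_⟩
      · rw [Prod.fst_add, Prod.smul_fst, Prod.smul_fst, hx1, hz1]
        funext i
        simp
      · have h1 := hU.2 (mem_univ f) (mem_univ f') hs ht hst
        obtain rfl : t = 1 - s := by linarith
        simp only [Prod.snd_add, Prod.smul_snd, smul_eq_mul] at h1 ⊢
        nlinarith)
    ⟨(fun i => L i f₀, P - penalty lam f₀), f₀, hf₀, rfl, le_rfl⟩
    (by
      rintro b ⟨f, hf, hb1, hb2⟩
      have := hPle f hf
      rw [VP] at this
      rw [hb1]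
      linarith)
  set α : Fin N → ℝ := fun i => g (Pi.single i 1) with hα
  have hgα : ∀ z, g z = ∑ i, α i * z i := by
    intro z
    conv_lhs => rw [pi_eq_sum_univ' z, map_sum]
    exact Finset.sum_congr rfl fun i _ => by rw [map_smul, smul_eq_mul, mul_comm]
  refine ⟨α, le_antisymm ?_ (neg_iInf_le_fenchelDual α)⟩
  have h1 : (⨆ f ∈ V, ((-(∑ i, α i * L i f) - penalty lam f : ℝ) : EReal)) ≤
      ((c - P : ℝ) : EReal) := by
    refine iSup₂_le fun f hf => EReal.coe_le_coe_iff.2 ?_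
    have := hg2 (fun i => L i f, P - penalty lam f) ⟨f, hf, rfl, le_rfl⟩
    simp only [hgα] at this
    linarith
  have h2 : (⨆ z : Fin N → ℝ, ((∑ i, α i * z i - ∑ i, ρ i (z i - y i) : ℝ) : EReal)) ≤
      ((-c : ℝ) : EReal) := by
    refine iSup_le fun z => EReal.coe_le_coe_iff.2 ?_
    have := hg1 z
    rw [hgα] at this
    linarith
  refine (add_le_add h1 h2).trans (le_of_eq ?_)
  rw [hP, ← EReal.coe_add, ← EReal.coe_neg]
  congr 1
  ring

/-- Optimality conditions for a primal-dual pair without duality gap. -/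
theorem subgradient_of_no_gap {f : W m p} (hf : f ∈ V) {α : Fin N → ℝ}
    (h : fenchelDual lam V L ρ y α = ((-VP lam L ρ y f : ℝ) : EReal)) (i : Fin N) (z : ℝ) :
    ρ i (L i f - y i) + α i * (z - (L i f - y i)) ≤ ρ i z := by
  classical
  have hV : V.Nonempty := ⟨f, hf⟩
  have : Nonempty V := hV.to_subtype
  have htop : fenchelDual lam V L ρ y α ≠ ⊤ := by rw [h]; exact EReal.coe_ne_top _
  have h' := (fenchelDual_ne_top_iff hV α).1 htop
  have e := fenchelDual_toReal hV htop
  rw [h, EReal.toReal_coe] at e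
  have h1 := iSup_coe_le h'.1 ⟨f, hf⟩
  simp only at h1
  -- These Fenchel–Young defects are nonnegative, and the absence of a gap makes their sum
  -- nonpositive, so each one vanishes.
  have h2 : ∀ j, 0 ≤ (conj (ρ j) (α j)).toReal - (α j * (L j f - y j) - ρ j (L j f - y j)) :=
    fun j => sub_nonneg.2 (le_conj (h'.2 j) _)
  have h3 : ∑ j, ((conj (ρ j) (α j)).toReal - (α j * (L j f - y j) - ρ j (L j f - y j))) ≤ 0 := by
    have e3 : ∑ j, ((conj (ρ j) (α j)).toReal - (α j * (L j f - y j) - ρ j (L j f - y j))) =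
        ∑ j, ((conj (ρ j) (α j)).toReal + α j * y j) - ∑ j, α j * L j f +
          ∑ j, ρ j (L j f - y j) := by
      rw [← Finset.sum_sub_distrib, ← Finset.sum_add_distrib]
      exact Finset.sum_congr rfl fun j _ => by ring
    rw [e3]
    rw [VP] at e
    linarith
  have h4 := (Finset.single_le_sum (fun j _ => h2 j) (Finset.mem_univ i)).trans h3
  have h5 := le_conj (h'.2 i) z
  linarith

end Fenchel

end RobustSpline

/-! ### Assembly of the duality theorem -/

open RobustSpline in
theorem mainTheorem2
    (m : ℕ) (hm : 1 ≤ m) (l : ℕ) (hl : l ≤ m)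
    (p : ℝ) (hp : 1 < p) (q : ℝ) (hq : q = p / (p - 1)) (lam : ℝ) (hlam : 0 < lam)
    (K : ℕ) (x : Fin K → ℝ) (hx : Monotone x) (hx01 : ∀ k, x k ∈ Set.Icc (0 : ℝ) 1)
    (N : ℕ) (L : Fin N → W m p →ₗ[ℝ] ℝ) (hL : ∀ i, IsBoundedFunctional (L i))
    (ρ : Fin N → ℝ → ℝ) (hρ : ∀ i, StrictConvexOn ℝ Set.univ (ρ i)) (hρc : ∀ i, Continuous (ρ i))
    (y : Fin N → ℝ) :
    -- the functional is the Fenchel dual of the constrained primal problem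
    (∀ α, dualVP hm q lam (coneV m p l x) L ρ y α = fenchelDual lam (coneV m p l x) L ρ y α) ∧
    -- it is convex with values in `(-∞, ∞]`, and strictly convex for differentiable `ρ_i`
    (∀ α, dualVP hm q lam (coneV m p l x) L ρ y α ≠ ⊥) ∧
    ConvexOn ℝ {α | dualVP hm q lam (coneV m p l x) L ρ y α ≠ ⊤}
      (fun α => (dualVP hm q lam (coneV m p l x) L ρ y α).toReal) ∧
    ((∀ i, Differentiable ℝ (ρ i)) →
      StrictConvexOn ℝ {α | dualVP hm q lam (coneV m p l x) L ρ y α ≠ ⊤}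
        (fun α => (dualVP hm q lam (coneV m p l x) L ρ y α).toReal)) ∧
    -- its minimum is attained and is the negative of the primal infimum
    (∃ α, IsMinOn (dualVP hm q lam (coneV m p l x) L ρ y) Set.univ α ∧
      dualVP hm q lam (coneV m p l x) L ρ y α =
        -(⨅ f ∈ coneV m p l x, (VP lam L ρ y f : EReal))) ∧
    -- optimality conditions for a primal minimizer `f` and a dual minimizer `α`
    (LinearIndependent ℝ L →
      ∀ f ∈ coneV m p l x, IsMinOn (VP lam L ρ y) (coneV m p l x) f →
      ∀ α, IsMinOn (dualVP hm q lam (coneV m p l x) L ρ y) Set.univ α →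
      ∀ i,
        (∀ z, ρ i (L i f - y i) + α i * (z - (L i f - y i)) ≤ ρ i z) ∧
        (DifferentiableAt ℝ (ρ i) (L i f - y i) → α i = deriv (ρ i) (L i f - y i)) ∧
        (∀ᶠ a in nhds (α i), conj (ρ i) a ≠ ⊤) ∧
        HasDerivAt (fun a => (conj (ρ i) a).toReal) (L i f - y i) (α i)) := by
  have hpq : p.HolderConjugate q := (Real.holderConjugate_iff_eq_conjExponent hp).2 hq
  have hV : (coneV m p l x).Nonempty := ⟨0, coneV_zero⟩
  have hVc : Convex ℝ (coneV m p l x) := fun f hf g hg s t hs ht _ =>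
    coneV_add hm hx01 (coneV_smul hs hf) (coneV_smul ht hg)
  have hdual : dualVP hm q lam (coneV m p l x) L ρ y =
      fenchelDual lam (coneV m p l x) L ρ y := by
    funext α
    rw [dualVP, fenchelDual, iSup_fidelity_eq, mul_projEnergy_eq hm hpq hlam coneV_zero
      (fun f hf g hg => coneV_add hm hx01 hf hg) (fun c hc f hf => coneV_smul hc hf) hL]
  rw [hdual]
  obtain ⟨α₀, hα₀⟩ := exists_dual_attaining (L := L) (y := y) hV hVc
    (penalty_convexOn hm hp.le hlam) (fun i => (hρ i).convexOn) hρc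
  refine ⟨fun α => rfl, fenchelDual_ne_bot hV, fenchelDual_convexOn hV,
    fenchelDual_strictConvexOn hV, ⟨α₀, fun α _ => ?_, hα₀⟩, fun _ f hf hfmin α hα i => ?_⟩
  · rw [Set.mem_ofPred_eq, hα₀]
    exact neg_iInf_le_fenchelDual α
  · have hinf : (⨅ f ∈ coneV m p l x, (VP lam L ρ y f : EReal)) = VP lam L ρ y f :=
      le_antisymm (iInf₂_le f hf) (le_iInf₂ fun g hg => EReal.coe_le_coe_iff.2 (hfmin hg))
    -- Any dual minimizer is at most the value at `α₀`, which is already the negative primal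
    -- minimum.
    have hgap : fenchelDual lam (coneV m p l x) L ρ y α = ((-VP lam L ρ y f : ℝ) : EReal) := by
      refine le_antisymm ((hα (Set.mem_univ α₀)).trans (le_of_eq ?_)) (weak_duality hf α)
      rw [hα₀, hinf, EReal.coe_neg]
    have hsub := subgradient_of_no_gap hf hgap i
    refine ⟨hsub, fun hd => ?_, conj_hasDerivAt (hρ i) hsub⟩
    -- The subgradient inequality says that `ρ i z - α i * z` is minimal at `L i f - y i`, so its
    -- derivative there vanishes.
    have hmin : IsLocalMin (fun z => ρ i z - α i * z) (L i f - y i) :=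
      Filter.Eventually.of_forall fun z => by linarith [hsub z]
    have hder : HasDerivAt (fun z => ρ i z - α i * z)
        (deriv (ρ i) (L i f - y i) - α i) (L i f - y i) := by
      simpa using hd.hasDerivAt.fun_sub ((hasDerivAt_id (L i f - y i)).const_mul (α i))
    linarith [hmin.hasDerivAt_eq_zero hder]
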